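/- Identify $\mathbb{C}^n$ with $\mathbb{R}^{2n}$ through the real and imaginary parts $x_1,\dots,x_{2n}$ of the complex coordinates. For $1\le j\le 2n$ write $x=(x_j,X_j)$, where $X_j\in\mathbb{R}^{2n-1}$ collects the coordinates other than $x_j$, and for $A\subset\mathbb{C}^n$ put $A(X_j)=\{x_j\in\mathbb{R} : (x_j,X_j)\in A\}$. Let $\mathcal{H}^{\alpha}$ denote $\alpha$-dimensional Hausdorff measure. **Theorem.** Let $\Omega$ be a domain in $\mathbb{C}^n$, $n\ge 1$, let $E\subset\Omega$ be closed in $\Omega$, and suppose $\mathcal{H}^{2n-1}(E)<+\infty$ (so that $E$ has Lebesgue measure zero). Let $f=u+iv:\Omega\setminus E\to\mathbb{C}$ be holomorphic, with $u,v$ real valued, such that: (i) $f\in\mathcal{L}^1_{\mathrm{loc}}(\Omega)$. (ii) For each $j$, $1\le j\le 2n$, $\dfrac{\partial^2u}{\partial x_j^2}\in\mathcal{L}^1_{\mathrm{loc}}(\Omega)$ and $\dfrac{\partial^2v}{\partial x_j^2}\in\mathcal{L}^1_{\mathrm{loc}}(\Omega)$. (iii) For each $j$, $1\le j\le 2n$,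 and for $\mathcal{H}^{2n-1}$-almost all $X_j\in\mathbb{R}^{2n-1}$ such that $E(X_j)$ is finite, the following holds: for each $x_j^0\in E(X_j)$ there exist sequences $a_l,b_l\in(\Omega\setminus E)(X_j)$, $l=1,2,\dots$, such that $a_l\nearrow x_j^0$ and $b_l\searrow x_j^0$ as $l\to+\infty$, and (a) $\displaystyle\lim_{l\to+\infty}f(a_l,X_j)=\lim_{l\to+\infty}f(b_l,X_j)\in\mathbb{C}$ (both limits exist), (b) $\displaystyle-\infty<\liminf_{l\to+\infty}\frac{\partial u}{\partial x_j}(a_l,X_j)=\limsup_{l\to+\infty}\frac{\partial u}{\partial x_j}(b_l,X_j)<+\infty$ and $\displaystyle-\infty<\liminf_{l\to+\infty}\frac{\partial v}{\partial x_j}(a_l,X_j)=\limsup_{l\to+\infty}\frac{\partial v}{\partial x_j}(b_l,X_j)<+\infty$. Then $f$ has a unique holomorphic extension to $\Omega$. -/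

import Mathlib

open Filter Topology MeasureTheory

noncomputable section

namespace HolExt

/-- `ℂⁿ` with its Euclidean norm. -/
abbrev CSpace (n : ℕ) : Type := EuclideanSpace ℂ (Fin n)

/-- Labels of the `2n` real coordinates of `ℂⁿ`: `(k, 0)` is the real part and `(k, 1)` the
imaginary part of the `k`-th complex coordinate. -/
abbrev RealIdx (n : ℕ) : Type := Fin n × Fin 2

/-- The identification of `ℝ²ⁿ` with `ℂⁿ`. -/
def ofReal {n : ℕ} (x : EuclideanSpace ℝ (RealIdx n)) : CSpace n :=
  WithLp.toLp 2 fun k => (⟨x (k, 0), x (k, 1)⟩ : ℂ)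

/-- The space `ℝ²ⁿ⁻¹` of all the real coordinates except the `j`-th one. -/
abbrev Others {n : ℕ} (j : RealIdx n) : Type := EuclideanSpace ℝ {i : RealIdx n // i ≠ j}

/-- The point `(x_j, X_j)` of `ℂⁿ` whose `j`-th real coordinate is `t` and whose other real
coordinates are given by `X`. -/
def point {n : ℕ} (j : RealIdx n) (t : ℝ) (X : Others j) : CSpace n :=
  ofReal (WithLp.toLp 2 fun i => if h : i = j then t else X ⟨i, h⟩)

/-- The slice `A(X_j)` of a set `A ⊆ ℂⁿ` along the coordinate line through `X`. -/
def slice {n : ℕ} (j : RealIdx n) (A : Set (CSpace n)) (X : Others j) : Set ℝ :=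
  {t : ℝ | point j t X ∈ A}

/-- The partial derivative `∂g/∂x_j` with respect to the `j`-th real coordinate. -/
def partialDeriv {n : ℕ} (j : RealIdx n) (g : CSpace n → ℝ) (z : CSpace n) : ℝ :=
  lineDeriv ℝ g z (ofReal (EuclideanSpace.single j 1))

/-- `g ∈ L¹_loc(Ω)` for a function `g` that is given on `Ω \ E` only: the values of `g` on `E`
play no role. -/
def L1loc {n : ℕ} {F : Type*} [NormedAddCommGroup F] (g : CSpace n → F)
    (Ω E : Set (CSpace n)) : Prop :=
  LocallyIntegrableOn g Ω (volume.restrict (Ω \ E))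

/-- For the real valued function `g` and the sequences `a`, `b` in the `j`-th coordinate line
through `X`: the lower limit of `∂g/∂x_j` along `a` and the upper limit of `∂g/∂x_j` along `b`,
both taken in `[-∞, ∞]`, are equal and finite. -/
def MatchingSlopes {n : ℕ} (j : RealIdx n) (g : CSpace n → ℝ) (X : Others j) (a b : ℕ → ℝ) :
    Prop :=
  ∃ s : ℝ,
    liminf (fun l => (partialDeriv j g (point j (a l) X) : EReal)) atTop = (s : EReal) ∧
    limsup (fun l => (partialDeriv j g (point j (b l) X) : EReal)) atTop = (s : EReal)

end HolExt

end

noncomputable section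

namespace HolExt

/-! The function `f` satisfies the Cauchy-Riemann equations weakly across `E`. A weak solution is
locally a.e. equal to a holomorphic function, and the two agree wherever `f` is continuous, hence
off `E` (`exists_holomorphic_of_weak`).

The weak equations follow from `∫ ∂φ • f = -∫ φ • ∂f` in each real coordinate
(`integral_fderiv_smul_eq`). By Fubini this is a question about lines parallel to the axes, almost
all of which meet `E` in finitely many points (`ae_finite_slice`). On almost every such line the
second derivative is locally integrable, so between exceptional points `∂f` is a constant plus a
primitive of it and has one-sided limits. The sequences in the hypothesis only have to make the
limits from the two sides agree (`noJump_of_matching`). Hence `∂f` is one primitive across all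
exceptional points, then so is `f` (`exists_eq_add_integral`), and integration by parts picks up no
terms from `E`.

Integrability of `∂f` in all variables is not assumed. It comes from integrating over the lines an
interpolation inequality that bounds `∫ |g'|` by `∫ |g''|` and `∫ |g|` (`interval_estimates`).

The local extensions glue because each is a continuous extension from the dense set `Ω \ E`; the
same remark gives uniqueness. -/

/-! ### Calculus on an interval with finitely many exceptional points -/

theorem exists_eqOn_const_of_hasDerivAt_zero {D : ℝ → ℂ} {p q : ℝ}
    (h : ∀ t ∈ Set.Ioo p q, HasDerivAt D 0 t) : ∃ d, ∀ t ∈ Set.Ioo p q, D t = d :=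
  isOpen_Ioo.exists_is_const_of_deriv_eq_zero isPreconnected_Ioo
    (fun t ht => (h t ht).differentiableAt.differentiableWithinAt) (fun t ht => (h t ht).deriv)

theorem hasDerivAt_primitive {g : ℝ → ℂ} {a b t : ℝ} (hg : IntervalIntegrable g volume a b)
    {U : Set ℝ} (hU : IsOpen U) (hUg : ContinuousOn g U) (htU : t ∈ U) (ht : t ∈ Set.Ioo a b) :
    HasDerivAt (fun s => ∫ x in a..s, g x) (g t) t := by
  have hsub : IntervalIntegrable g volume a t := hg.mono_set (by
    rw [Set.uIcc_of_le ht.1.le, Set.uIcc_of_le (ht.1.trans ht.2).le]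
    exact Set.Icc_subset_Icc_right ht.2.le)
  exact intervalIntegral.integral_hasDerivAt_right hsub
    (hUg.stronglyMeasurableAtFilter hU t htU) (hUg.continuousAt (hU.mem_nhds htU))

/-- A function that is differentiable off a finite set, with integrable derivative and with no jump
at the exceptional points, is a primitive of its derivative. -/
theorem exists_eq_add_integral {g g' : ℝ → ℂ} {a b : ℝ} {S : Set ℝ} (hS : S.Finite)
    (hg : ∀ t ∈ Set.Ioo a b \ S, HasDerivAt g (g' t) t)
    (hc : ContinuousOn g' (Set.Ioo a b \ S))
    (hi : IntervalIntegrable g' volume a b)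
    (hm : ∀ x ∈ S ∩ Set.Ioo a b, ∀ l r : ℂ, Tendsto g (𝓝[<] x) (𝓝 l) →
      Tendsto g (𝓝[>] x) (𝓝 r) → l = r) :
    ∃ d, ∀ t ∈ Set.Ioo a b \ S, g t = d + ∫ x in a..t, g' x := by
  have hU : IsOpen (Set.Ioo a b \ S) := isOpen_Ioo.sdiff hS.isClosed
  set P : ℝ → ℂ := fun s => ∫ x in a..s, g' x with hP
  set D : ℝ → ℂ := fun s => g s - P s with hD
  have hPc : ∀ x ∈ Set.Ioo a b, ContinuousAt P x := fun x hx => by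
    have := intervalIntegral.continuousOn_primitive_interval' hi (Set.left_mem_uIcc)
    refine this.continuousAt ?_
    rw [Set.uIcc_of_le (hx.1.trans hx.2).le]
    exact Icc_mem_nhds hx.1 hx.2
  have hD0 : ∀ t ∈ Set.Ioo a b \ S, HasDerivAt D 0 t := fun t ht => by
    have h := (hg t ht).sub (hasDerivAt_primitive hi hU hc ht ht.1)
    rw [sub_self] at h
    exact h
  have hm' : ∀ x ∈ Set.Ioo a b, ∀ l r : ℂ, Tendsto g (𝓝[<] x) (𝓝 l) →
      Tendsto g (𝓝[>] x) (𝓝 r) → l = r := by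
    intro x hx l r hl hr
    by_cases hxS : x ∈ S
    · exact hm x ⟨hxS, hx⟩ l r hl hr
    · have := (hg x ⟨hx, hxS⟩).continuousAt.tendsto
      rw [tendsto_nhds_unique hl (this.mono_left nhdsWithin_le_nhds),
        tendsto_nhds_unique hr (this.mono_left nhdsWithin_le_nhds)]
  -- Near `x` no other point of `S` occurs, so `D` is constant on each side. As `P` is continuous,
  -- `g` then has one-sided limits at `x`, and the no-jump hypothesis equates the two constants.
  have key : ∀ x ∈ Set.Ioo a b, ∃ d, ∀ᶠ s in 𝓝[≠] x, D s = d := by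
    intro x hx
    have h1 : Set.Ioo a b \ (S \ {x}) ∈ 𝓝 x :=
      (isOpen_Ioo.sdiff (hS.subset Set.sdiff_subset).isClosed).mem_nhds ⟨hx, fun h => h.2 rfl⟩
    obtain ⟨ε, hε, hb⟩ := Metric.mem_nhds_iff.1 h1
    rw [Real.ball_eq_Ioo] at hb
    obtain ⟨l, hl⟩ := exists_eqOn_const_of_hasDerivAt_zero (D := D) (p := x - ε) (q := x)
      (fun t ht => hD0 t (by
        have := hb ⟨ht.1, ht.2.trans (by linarith)⟩
        exact ⟨this.1, fun h => this.2 ⟨h, ht.2.ne⟩⟩))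
    obtain ⟨r, hr⟩ := exists_eqOn_const_of_hasDerivAt_zero (D := D) (p := x) (q := x + ε)
      (fun t ht => hD0 t (by
        have := hb ⟨lt_trans (by linarith) ht.1, ht.2⟩
        exact ⟨this.1, fun h => this.2 ⟨h, ht.1.ne'⟩⟩))
    have hl' : ∀ᶠ s in 𝓝[<] x, D s = l :=
      mem_of_superset (Ioo_mem_nhdsLT (by linarith : x - ε < x)) hl
    have hr' : ∀ᶠ s in 𝓝[>] x, D s = r :=
      mem_of_superset (Ioo_mem_nhdsGT (by linarith : x < x + ε)) hr
    have tl : Tendsto g (𝓝[<] x) (𝓝 (l + P x)) := by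
      refine Tendsto.congr' (f₁ := fun s => l + P s) ?_
        (((hPc x hx).tendsto.mono_left nhdsWithin_le_nhds).const_add l)
      filter_upwards [hl'] with s hs
      rw [← hs]; simp [hD]
    have tr : Tendsto g (𝓝[>] x) (𝓝 (r + P x)) := by
      refine Tendsto.congr' (f₁ := fun s => r + P s) ?_
        (((hPc x hx).tendsto.mono_left nhdsWithin_le_nhds).const_add r)
      filter_upwards [hr'] with s hs
      rw [← hs]; simp [hD]
    have hlr : l = r := by simpa using hm' x hx _ _ tl tr
    refine ⟨l, ?_⟩
    rw [← nhdsLT_sup_nhdsGT]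
    exact eventually_sup.2 ⟨hl', hlr ▸ hr'⟩
  choose! d hd using key
  -- The punctured-neighbourhood value `d` is defined at the exceptional points too and is locally
  -- constant, hence constant on the whole connected interval.
  have hdd : ∀ x ∈ Set.Ioo a b, d =ᶠ[𝓝 x] fun _ => d x := by
    intro x hx
    have h1 := eventually_eventually_nhdsWithin.2 (hd x hx)
    suffices h : ∀ᶠ y in 𝓝[≠] x, d y = d x by
      have h' := eventually_nhdsWithin_iff.1 h
      filter_upwards [h'] with y hy
      by_cases hyx : y = x
      · rw [hyx]
      · exact hy hyx
    have h2 : ∀ᶠ y in 𝓝[≠] x, y ∈ Set.Ioo a b :=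
      nhdsWithin_le_nhds (isOpen_Ioo.mem_nhds hx)
    filter_upwards [h1, h2, self_mem_nhdsWithin] with y hy hy2 hne
    have h3 : ∀ᶠ s in 𝓝[≠] y, D s = d x := by
      rw [isOpen_compl_singleton.nhdsWithin_eq hne] at hy
      exact nhdsWithin_le_nhds hy
    obtain ⟨s, hs1, hs2⟩ := ((hd y hy2).and h3).exists
    rw [← hs1, hs2]
  obtain ⟨e, he⟩ := exists_eqOn_const_of_hasDerivAt_zero (D := d) (p := a) (q := b)
    (fun t ht => (hasDerivAt_const t (d t)).congr_of_eventuallyEq (hdd t ht))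
  refine ⟨e, fun t ht => ?_⟩
  have h1 : Tendsto D (𝓝[≠] t) (𝓝 (D t)) :=
    (hD0 t ht).continuousAt.tendsto.mono_left nhdsWithin_le_nhds
  have h2 : Tendsto D (𝓝[≠] t) (𝓝 (d t)) :=
    tendsto_const_nhds.congr' (by filter_upwards [hd t ht.1] with s hs using hs.symm)
  have h3 := tendsto_nhds_unique h1 h2
  rw [he t ht.1] at h3
  rw [← h3]
  exact (sub_add_cancel _ _).symm

/-- Integration by parts and the interpolation inequality on an interval, for a function with
finitely many exceptional points at which neither it nor its derivative jumps. -/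
theorem interval_estimates {g g' g'' : ℝ → ℂ} {a b : ℝ} (hab : a < b) {S : Set ℝ}
    (hS : S.Finite)
    (hg : ∀ t ∈ Set.Ioo a b \ S, HasDerivAt g (g' t) t)
    (hg' : ∀ t ∈ Set.Ioo a b \ S, HasDerivAt g' (g'' t) t)
    (hc : ContinuousOn g'' (Set.Ioo a b \ S))
    (hi'' : IntervalIntegrable g'' volume a b)
    (hm : ∀ x ∈ S ∩ Set.Ioo a b, ∀ l r : ℂ, Tendsto g (𝓝[<] x) (𝓝 l) →
      Tendsto g (𝓝[>] x) (𝓝 r) → l = r)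
    (hm' : ∀ x ∈ S ∩ Set.Ioo a b, ∀ l r : ℂ, Tendsto g' (𝓝[<] x) (𝓝 l) →
      Tendsto g' (𝓝[>] x) (𝓝 r) → l = r) :
    IntervalIntegrable g' volume a b ∧
    ∫ t in a..b, ‖g' t‖ ≤
      (b - a) * (∫ t in a..b, ‖g'' t‖) + 4 / (b - a) * ∫ t in a..b, ‖g t‖ ∧
    ∀ φ φ' : ℝ → ℝ, (∀ t, HasDerivAt φ (φ' t) t) → Continuous φ' → φ a = 0 → φ b = 0 →
      ∫ t in a..b, φ' t • g t = -∫ t in a..b, φ t • g' t := by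
  have hU : IsOpen (Set.Ioo a b \ S) := isOpen_Ioo.sdiff hS.isClosed
  have hae : ∀ᵐ t ∂volume.restrict (Set.uIoc a b), t ∈ Set.Ioo a b \ S := by
    rw [Set.uIoc_of_le hab.le, ae_restrict_iff' measurableSet_Ioc]
    filter_upwards [hS.countable.ae_notMem volume, (Set.countable_singleton b).ae_notMem volume]
      with t h1 h2 h3
    exact ⟨⟨h3.1, lt_of_le_of_ne h3.2 h2⟩, h1⟩
  have hae' : ∀ᵐ t, t ∈ Set.uIoc a b → t ∈ Set.Ioo a b \ S :=
    (ae_restrict_iff' measurableSet_uIoc).1 hae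
  -- First for `g'`: being a.e. equal to a continuous function, it is integrable, which is what the
  -- same lemma needs when applied to `g`.
  obtain ⟨d₁, hd₁⟩ := exists_eq_add_integral hS hg' hc hi'' hm'
  have hprim : ∀ {k : ℝ → ℂ}, IntervalIntegrable k volume a b → ∀ d : ℂ,
      ContinuousOn (fun t => d + ∫ x in a..t, k x) (Set.uIcc a b) := fun hk d =>
    continuousOn_const.add
      (intervalIntegral.continuousOn_primitive_interval' hk Set.left_mem_uIcc)
  have hi' : IntervalIntegrable g' volume a b := by
    refine (hprim hi'' d₁).intervalIntegrable.congr_ae ?_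
    filter_upwards [hae] with t ht using (hd₁ t ht).symm
  have hg'c : ContinuousOn g' (Set.Ioo a b \ S) := fun t ht =>
    (hg' t ht).continuousAt.continuousWithinAt
  obtain ⟨d₀, hd₀⟩ := exists_eq_add_integral hS hg hg'c hi' hm
  set G : ℝ → ℂ := fun t => d₀ + ∫ x in a..t, g' x with hG
  have hGc : ContinuousOn G (Set.uIcc a b) := hprim hi' d₀
  have hGg : ∀ᵐ t ∂volume.restrict (Set.uIoc a b), g t = G t := by
    filter_upwards [hae] with t ht using hd₀ t ht
  set A := ∫ t in a..b, ‖g'' t‖ with hA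
  have hosc : ∀ t ∈ Set.Ioo a b \ S, ∀ x ∈ Set.Ioo a b \ S, ‖g' t - g' x‖ ≤ A := by
    intro t ht x hx
    have hsub : ∀ y ∈ Set.Ioo a b \ S, IntervalIntegrable g'' volume a y := fun y hy =>
      hi''.mono_set (by
        rw [Set.uIcc_of_le hy.1.1.le, Set.uIcc_of_le hab.le]
        exact Set.Icc_subset_Icc_right hy.1.2.le)
    rw [hd₁ t ht, hd₁ x hx, add_sub_add_left_eq_sub,
      intervalIntegral.integral_interval_sub_left (hsub t ht) (hsub x hx)]
    refine (intervalIntegral.norm_integral_le_integral_norm_uIoc).trans ?_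
    rw [hA, intervalIntegral.integral_of_le hab.le]
    refine setIntegral_mono_set ?_ (ae_of_all _ fun _ => norm_nonneg _) ?_
    · exact ((intervalIntegrable_iff_integrableOn_Ioc_of_le hab.le).1 hi'').norm
    · refine ae_of_all _ fun y (hy : y ∈ Set.uIoc x t) => ?_
      rw [Set.mem_uIoc] at hy
      rcases hy with hy | hy
      · exact ⟨hx.1.1.trans hy.1, hy.2.trans ht.1.2.le⟩
      · exact ⟨ht.1.1.trans hy.1, hy.2.trans hx.1.2.le⟩
  -- By `hosc`, `h * g' t` differs from `G (s + h) - G s`, the integral of `g'` over a window of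
  -- length `h`, by at most `h * A`. With `h` half the length, `s` and `s + h` for `s ∈ [a, a + h]`
  -- together sweep `[a, b]` exactly once, so integrating in `s` produces the full integral of
  -- `‖G‖`.
  set h := (b - a) / 2 with hh
  have hpos : 0 < h := by rw [hh]; linarith
  have hbh : a + h + h = b := by rw [hh]; ring
  have hbound : ∀ t ∈ Set.Ioo a b \ S, ‖g' t‖ ≤ A + (∫ s in a..b, ‖g s‖) / h ^ 2 := by
    intro t ht
    have h1 : ∀ s ∈ Set.Icc a (a + h), h * ‖g' t‖ ≤ h * A + (‖G (s + h)‖ + ‖G s‖) := by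
      intro s hs
      have hsub : ∀ y ∈ Set.Icc a b, IntervalIntegrable g' volume a y := fun y hy =>
        hi'.mono_set (by
          rw [Set.uIcc_of_le hy.1, Set.uIcc_of_le hab.le]
          exact Set.Icc_subset_Icc_right hy.2)
      have hs1 : s ∈ Set.Icc a b := ⟨hs.1, by linarith [hs.2]⟩
      have hs2 : s + h ∈ Set.Icc a b := ⟨by linarith [hs.1], by linarith [hs.2]⟩
      have e1 : G (s + h) - G s = ∫ x in s..s + h, g' x := by
        simp only [hG]
        rw [add_sub_add_left_eq_sub,
          intervalIntegral.integral_interval_sub_left (hsub _ hs2) (hsub _ hs1)]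
      have hsi : IntervalIntegrable g' volume s (s + h) := (hsub _ hs1).symm.trans (hsub _ hs2)
      have e2 : ∫ x in s..s + h, (g' t - g' x) = h • g' t - (G (s + h) - G s) := by
        rw [intervalIntegral.integral_sub (by simp) hsi, e1]
        simp
      have e3 : ‖∫ x in s..s + h, (g' t - g' x)‖ ≤ A * |s + h - s| := by
        refine intervalIntegral.norm_integral_le_of_norm_le_const_ae ?_
        filter_upwards [hae'] with x hx hx'
        refine hosc t ht x (hx ?_)
        rw [Set.uIoc_of_le (by linarith)] at hx'
        rw [Set.uIoc_of_le hab.le]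
        exact ⟨hs1.1.trans_lt hx'.1, hx'.2.trans hs2.2⟩
      have e4 : |s + h - s| = h := by rw [add_sub_cancel_left, abs_of_pos hpos]
      rw [e4, e2] at e3
      have e5 : h * ‖g' t‖ = ‖h • g' t‖ := by
        rw [norm_smul, Real.norm_eq_abs, abs_of_pos hpos]
      calc h * ‖g' t‖ = ‖(h • g' t - (G (s + h) - G s)) + (G (s + h) - G s)‖ := by
            rw [sub_add_cancel, e5]
        _ ≤ ‖h • g' t - (G (s + h) - G s)‖ + ‖G (s + h) - G s‖ := norm_add_le _ _
        _ ≤ h * A + (‖G (s + h)‖ + ‖G s‖) := by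
            have := norm_sub_le (G (s + h)) (G s)
            linarith
    have hGn : ContinuousOn (fun s => ‖G s‖) (Set.Icc a b) := by
      rw [← Set.uIcc_of_le hab.le]; exact hGc.norm
    have c1 : ContinuousOn (fun s => ‖G s‖) (Set.uIcc a (a + h)) :=
      hGn.mono (by rw [Set.uIcc_of_le (by linarith)]; exact Set.Icc_subset_Icc_right (by linarith))
    have c2 : ContinuousOn (fun s => ‖G s‖) (Set.uIcc (a + h) b) :=
      hGn.mono (by rw [Set.uIcc_of_le (by linarith)]; exact Set.Icc_subset_Icc_left (by linarith))
    have c3 : ContinuousOn (fun s => ‖G (s + h)‖) (Set.uIcc a (a + h)) := by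
      refine hGn.comp (f := fun s => s + h) (by fun_prop) ?_
      rw [Set.uIcc_of_le (by linarith)]
      intro s hs
      exact ⟨by linarith [hs.1], by linarith [hs.2]⟩
    have h2 := intervalIntegral.integral_mono_on (μ := volume) (by linarith : a ≤ a + h)
      (f := fun _ => h * ‖g' t‖) (g := fun s => h * A + (‖G (s + h)‖ + ‖G s‖)) (by simp)
      (by
        exact (continuousOn_const.add (c3.add c1)).intervalIntegrable) h1
    have c4 : IntervalIntegrable (fun s => ‖G (s + h)‖ + ‖G s‖) volume a (a + h) :=
      (c3.add c1).intervalIntegrable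
    rw [intervalIntegral.integral_add (by simp) c4,
      intervalIntegral.integral_add c3.intervalIntegrable c1.intervalIntegrable,
      intervalIntegral.integral_comp_add_right (fun s => ‖G s‖) h, hbh,
      add_comm (∫ x in (a + h)..b, ‖G x‖),
      intervalIntegral.integral_add_adjacent_intervals c1.intervalIntegrable
        c2.intervalIntegrable] at h2
    simp only [intervalIntegral.integral_const, add_sub_cancel_left, smul_eq_mul] at h2
    have h3 : ∫ s in a..b, ‖G s‖ = ∫ s in a..b, ‖g s‖ := by
      refine intervalIntegral.integral_congr_ae_restrict ?_
      filter_upwards [hGg] with s hs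
      rw [hs]
    rw [h3] at h2
    rw [← sub_le_iff_le_add', le_div_iff₀ (by positivity)]
    nlinarith
  refine ⟨hi', ?_, ?_⟩
  · have h2 : ∫ t in a..b, ‖g' t‖ ≤ ∫ t in a..b, (A + (∫ s in a..b, ‖g s‖) / h ^ 2) := by
      rw [intervalIntegral.integral_of_le hab.le, intervalIntegral.integral_of_le hab.le]
      refine integral_mono_ae
        ((intervalIntegrable_iff_integrableOn_Ioc_of_le hab.le).1 hi').norm (by simp) ?_
      rw [Set.uIoc_of_le hab.le] at hae
      filter_upwards [hae] with t ht using hbound t ht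
    refine h2.trans (le_of_eq ?_)
    rw [intervalIntegral.integral_const, hh, smul_eq_mul]
    have : b - a ≠ 0 := by linarith
    field_simp
    ring
  · intro φ φ' hφ hφ'c ha hb
    have hφc : Continuous φ := continuous_iff_continuousAt.2 fun t => (hφ t).continuousAt
    have i1 : IntervalIntegrable (fun t => φ' t • G t) volume a b :=
      (hφ'c.continuousOn.smul hGc).intervalIntegrable
    have i2 : IntervalIntegrable (fun t => φ t • g' t) volume a b :=
      hi'.continuousOn_smul hφc.continuousOn
    have h1 := integral_eq_of_hasDerivAt_off_countable (a := a) (b := b) (s := S)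
      (fun t => φ t • G t) (fun t => φ t • g' t + φ' t • G t) hS.countable
      (hφc.continuousOn.smul hGc) (by
        rw [min_eq_left hab.le, max_eq_right hab.le]
        intro t ht
        exact (hφ t).smul ((hasDerivAt_primitive hi' hU hg'c ht ht.1).const_add d₀)) (i2.add i1)
    rw [intervalIntegral.integral_add i2 i1, ha, hb, zero_smul, zero_smul, sub_zero] at h1
    have h3 : ∫ s in a..b, φ' s • g s = ∫ s in a..b, φ' s • G s := by
      refine intervalIntegral.integral_congr_ae_restrict ?_
      filter_upwards [hGg] with s hs
      rw [hs]
    rw [h3]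
    exact eq_neg_of_add_eq_zero_right h1

/-! ### Real coordinates on `ℂⁿ` -/

variable {n : ℕ}

/-- The direction of the `j`-th real coordinate in `ℂⁿ`. -/
def dir (j : RealIdx n) : CSpace n := ofReal (EuclideanSpace.single j 1)

/-- The `j`-th real coordinate. -/
def coord (j : RealIdx n) (z : CSpace n) : ℝ := if j.2 = 0 then (z j.1).re else (z j.1).im

@[fun_prop]
theorem continuous_coord (j : RealIdx n) : Continuous (coord j) := by
  unfold coord
  split_ifs <;> fun_prop

/-- All the real coordinates but the `j`-th one. -/
def others (j : RealIdx n) (z : CSpace n) : Others j := WithLp.toLp 2 fun i => coord i.1 z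

theorem coord_ofReal (j : RealIdx n) (x : EuclideanSpace ℝ (RealIdx n)) :
    coord j (ofReal x) = x j := by
  obtain ⟨k, i⟩ := j
  fin_cases i <;> simp [coord, ofReal]

theorem coord_point (j : RealIdx n) (t : ℝ) (X : Others j) : coord j (point j t X) = t := by
  simp [point, coord_ofReal]

theorem others_point (j : RealIdx n) (t : ℝ) (X : Others j) : others j (point j t X) = X := by
  ext i
  simp [point, others, coord_ofReal, i.2]

theorem ext_coord {z w : CSpace n} (h : ∀ j, coord j z = coord j w) : z = w := by
  ext k
  exact Complex.ext (by simpa [coord] using h (k, 0)) (by simpa [coord] using h (k, 1))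

theorem point_others (j : RealIdx n) (z : CSpace n) : point j (coord j z) (others j z) = z := by
  refine ext_coord fun i => ?_
  rw [point, coord_ofReal]
  by_cases h : i = j
  · subst h; simp
  · simp [h, others]

theorem coord_add (j : RealIdx n) (z w : CSpace n) : coord j (z + w) = coord j z + coord j w := by
  unfold coord; split_ifs <;> simp

theorem coord_smul (j : RealIdx n) (c : ℝ) (w : CSpace n) : coord j (c • w) = c * coord j w := by
  unfold coord; split_ifs <;> simp

/-- The splitting of `ℂⁿ` into the `j`-th real coordinate and the other ones. -/
def pointEquiv (j : RealIdx n) : (Others j × ℝ) ≃L[ℝ] CSpace n :=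
  (LinearEquiv.symm
    { toFun := fun z => (others j z, coord j z)
      invFun := fun p => point j p.2 p.1
      left_inv := fun z => point_others j z
      right_inv := fun p => Prod.ext (others_point j p.2 p.1) (coord_point j p.2 p.1)
      map_add' := fun z w => Prod.ext (by ext i; simp [others, coord_add]) (coord_add j z w)
      map_smul' := fun c w => Prod.ext (by ext i; simp [others, coord_smul])
        (coord_smul j c w) }).toContinuousLinearEquiv

theorem coord_dir (i j : RealIdx n) : coord i (dir j) = if i = j then 1 else 0 := by
  rw [dir, coord_ofReal]; simp

theorem point_add (j : RealIdx n) (t s : ℝ) (X : Others j) :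
    point j (t + s) X = point j t X + s • dir j := by
  refine ext_coord fun i => ?_
  rw [coord_add, coord_smul, coord_dir, point, point, coord_ofReal, coord_ofReal]
  by_cases h : i = j
  · subst h; simp
  · simp [h]

theorem dir_one (k : Fin n) : dir (k, 1) = Complex.I • dir (k, 0) := by
  ext i
  by_cases h : i = k
  · subst h; simp [dir, ofReal, Complex.ext_iff]
  · simp [dir, ofReal, Complex.ext_iff, h]

theorem norm_sq_eq_sum_coord (z : CSpace n) : ‖z‖ ^ 2 = ∑ j, coord j z ^ 2 := by
  rw [EuclideanSpace.norm_sq_eq, Fintype.sum_prod_type]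
  refine Finset.sum_congr rfl fun k _ => ?_
  rw [← Complex.normSq_eq_norm_sq, Complex.normSq_apply]
  simp [coord, sq]

theorem norm_sq_eq_coord_add_others (j : RealIdx n) (z : CSpace n) :
    ‖z‖ ^ 2 = coord j z ^ 2 + ‖others j z‖ ^ 2 := by
  rw [norm_sq_eq_sum_coord, EuclideanSpace.norm_sq_eq, ← Fintype.sum_subtype_add_sum_subtype
    (fun i => i ≠ j), add_comm]
  congr 1
  · have : Unique {i : RealIdx n // ¬ i ≠ j} :=
      ⟨⟨⟨j, by simp⟩⟩, fun i => Subtype.ext (not_not.1 i.2)⟩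
    rw [Fintype.sum_unique]
    rw [not_not.1 (default : {i : RealIdx n // ¬ i ≠ j}).2]
  · simp [others]

theorem others_sub (j : RealIdx n) (z w : CSpace n) :
    others j (z - w) = others j z - others j w :=
  congrArg Prod.fst ((pointEquiv j).symm.map_sub z w)

theorem coord_sub (j : RealIdx n) (z w : CSpace n) :
    coord j (z - w) = coord j z - coord j w :=
  congrArg Prod.snd ((pointEquiv j).symm.map_sub z w)

theorem norm_others_le (j : RealIdx n) (z : CSpace n) : ‖others j z‖ ≤ ‖z‖ := by
  have := norm_sq_eq_coord_add_others j z
  exact abs_le_of_sq_le_sq' (by nlinarith [sq_nonneg (coord j z)]) (norm_nonneg _) |>.2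

theorem abs_coord_le (j : RealIdx n) (z : CSpace n) : |coord j z| ≤ ‖z‖ := by
  have := norm_sq_eq_coord_add_others j z
  exact abs_le_of_sq_le_sq (by nlinarith [sq_nonneg ‖others j z‖]) (norm_nonneg _)

theorem norm_le_coord_add_others (j : RealIdx n) (z : CSpace n) :
    ‖z‖ ≤ ‖others j z‖ + |coord j z| := by
  have := norm_sq_eq_coord_add_others j z
  refine abs_le_of_sq_le_sq' ?_ (by positivity) |>.2
  rw [this, ← sq_abs (coord j z)]
  nlinarith [mul_nonneg (norm_nonneg (others j z)) (abs_nonneg (coord j z))]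

theorem lipschitzWith_others (j : RealIdx n) : LipschitzWith 1 (others j) :=
  LipschitzWith.of_dist_le_mul fun z w => by
    rw [dist_eq_norm, dist_eq_norm, ← others_sub, NNReal.coe_one, one_mul]
    exact norm_others_le j _

/-! ### Hausdorff measure, Haar measure and finite slices -/

theorem finrank_others (hn : 1 ≤ n) (j : RealIdx n) :
    (Module.finrank ℝ (Others j) : ℝ) = 2 * (n : ℝ) - 1 := by
  have : Module.finrank ℝ (Others j) + 1 = 2 * n := by simp; omega
  have h : (Module.finrank ℝ (Others j) : ℝ) + 1 = 2 * n := by exact_mod_cast this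
  linarith

theorem isAddHaarMeasure_others (hn : 1 ≤ n) (j : RealIdx n) :
    (μH[2 * (n : ℝ) - 1] : Measure (Others j)).IsAddHaarMeasure := by
  rw [← finrank_others hn j]
  exact isAddHaarMeasure_hausdorffMeasure

/-- Finite measure in dimension `2n - 1` forces measure zero in dimension `2n`, where Hausdorff
measure is a Haar measure and so has the same null sets as `volume`. -/
theorem volume_eq_zero_of_hausdorffMeasure_lt_top {E : Set (CSpace n)}
    (hE : μH[2 * (n : ℝ) - 1] E < ⊤) : volume E = 0 := by
  have h1 : (μH[2 * (n : ℝ)] : Measure (CSpace n)) E = 0 :=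
    (Measure.hausdorffMeasure_zero_or_top (by linarith) E).resolve_right hE.ne
  have h2 : (Module.finrank ℝ (CSpace n) : ℝ) = 2 * n := by
    have : Module.finrank ℝ (CSpace n) = 2 * n := by
      rw [← Module.finrank_mul_finrank ℝ ℂ (CSpace n)]; simp
    exact_mod_cast this
  rw [← h2] at h1
  have h3 : (μH[(Module.finrank ℝ (CSpace n) : ℝ)] : Measure (CSpace n)).IsAddHaarMeasure :=
    isAddHaarMeasure_hausdorffMeasure
  exact Measure.absolutelyContinuous_isAddHaarMeasure volume
    (μH[(Module.finrank ℝ (CSpace n) : ℝ)]) h1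

/-- Haar measures are proportional. The value of `c` is irrelevant: it cancels from the identities
proved by Fubini. -/
theorem exists_map_pointEquiv (j : RealIdx n) (μ : Measure (Others j)) [μ.IsAddHaarMeasure] :
    ∃ c : NNReal, c ≠ 0 ∧
      (μ.prod (volume : Measure ℝ)).map (pointEquiv j) = c • (volume : Measure (CSpace n)) := by
  have h : ((μ.prod (volume : Measure ℝ)).map (pointEquiv j)).IsAddHaarMeasure :=
    (pointEquiv j).isAddHaarMeasure_map _
  exact ⟨_, (Measure.addHaarScalarFactor_pos_of_isAddHaarMeasure _ _).ne',
    Measure.isAddLeftInvariant_eq_smul _ volume⟩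

/-- Eilenberg's inequality in qualitative form: almost every line parallel to a coordinate axis
meets a set of finite codimension-one Hausdorff measure in finitely many points. -/
theorem ae_finite_slice (hn : 1 ≤ n) {E : Set (CSpace n)} (hE : μH[2 * (n : ℝ) - 1] E < ⊤)
    (j : RealIdx n) : ∀ᵐ X : Others j ∂μH[2 * (n : ℝ) - 1], (slice j E X).Finite := by
  set d : ℝ := 2 * (n : ℝ) - 1 with hd
  have hd0 : 0 ≤ d := by
    have : (1 : ℝ) ≤ n := by exact_mod_cast hn
    linarith
  -- Slabs of width `1 / (k + 1)` orthogonal to the `j`-th axis. `N k X` counts the slabs in which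
  -- the line through `X` meets `E`, up to enlarging each projection to a measurable hull of the
  -- same measure, since projections need not be measurable. Projection is 1-Lipschitz and the slabs
  -- are disjoint, so `∫ N k` is at most the measure of `E`, uniformly in `k`; Fatou then applies.
  set T : ℕ → ℤ → Set (CSpace n) := fun k i => {z | ⌊((k : ℝ) + 1) * coord j z⌋ = i} with hT
  have hTm : ∀ k i, MeasurableSet (T k i) := fun k i =>
    (Int.measurable_floor.comp
      (((continuous_coord j).measurable).const_mul ((k : ℝ) + 1))) (measurableSet_singleton i)
  set A : ℕ → ℤ → Set (Others j) := fun k i => toMeasurable μH[d] (others j '' (E ∩ T k i))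
  set N : ℕ → Others j → ENNReal := fun k X => ∑' i, (A k i).indicator 1 X with hN
  have hAm : ∀ k i, MeasurableSet (A k i) := fun k i => measurableSet_toMeasurable _ _
  have hNm : ∀ k, Measurable (N k) := fun k =>
    Measurable.tsum fun i => measurable_one.indicator (hAm k i)
  have hNint : ∀ k, ∫⁻ X, N k X ∂μH[d] ≤ μH[d] E := by
    intro k
    rw [lintegral_tsum fun i => (measurable_one.indicator (hAm k i)).aemeasurable]
    calc ∑' i, ∫⁻ X, (A k i).indicator 1 X ∂μH[d]
        = ∑' i, μH[d] (others j '' (E ∩ T k i)) := by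
          refine tsum_congr fun i => ?_
          rw [lintegral_indicator_one (hAm k i), measure_toMeasurable]
      _ ≤ ∑' i, (μH[d].restrict E) (T k i) := by
          refine ENNReal.tsum_le_tsum fun i => ?_
          rw [Measure.restrict_apply (hTm k i), Set.inter_comm]
          simpa using (lipschitzWith_others j).hausdorffMeasure_image_le hd0 (T k i ∩ E)
      _ = (μH[d].restrict E) (⋃ i, T k i) := by
          refine (measure_iUnion ?_ (hTm k)).symm
          intro i i' hii
          refine Set.disjoint_left.2 fun z hz hz' => hii ?_
          exact (show ⌊((k : ℝ) + 1) * coord j z⌋ = i from hz).symm.trans hz'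
      _ ≤ μH[d] E := by
          refine (measure_mono (Set.subset_univ _)).trans ?_
          rw [Measure.restrict_apply_univ]
  have hfatou : ∫⁻ X, liminf (fun k => N k X) atTop ∂μH[d] < ⊤ := by
    refine (lintegral_liminf_le hNm).trans_lt (lt_of_le_of_lt ?_ hE)
    exact liminf_le_of_le (by isBoundedDefault) fun b hb => by
      obtain ⟨k, hk⟩ := hb.exists
      exact hk.trans (hNint k)
  filter_upwards [ae_lt_top (Measurable.liminf hNm) hfatou.ne] with X hX
  by_contra hinf
  refine hX.ne (top_le_iff.1 ?_)
  refine ENNReal.le_of_forall_nnreal_lt fun r _ => ?_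
  obtain ⟨m, hm⟩ := exists_nat_ge r
  obtain ⟨F, hF, hFc⟩ := Set.Infinite.exists_subset_card_eq hinf m
  -- Thin enough slabs separate any `m` chosen points of the slice, so `N k X ≥ m` eventually. An
  -- infinite slice would therefore make the lower limit infinite.
  have hinj : ∀ᶠ k : ℕ in atTop, ∀ x ∈ F, ∀ y ∈ F,
      ⌊((k : ℝ) + 1) * x⌋ = ⌊((k : ℝ) + 1) * y⌋ → x = y := by
    refine (Filter.eventually_all_finset F).2 fun x _ => (Filter.eventually_all_finset F).2
      fun y _ => ?_
    by_cases hxy : x = y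
    · exact Eventually.of_forall fun _ _ => hxy
    · have hpos : 0 < |x - y| := abs_pos.2 (sub_ne_zero.2 hxy)
      obtain ⟨K, hK⟩ := exists_nat_ge (1 / |x - y|)
      filter_upwards [eventually_ge_atTop K] with k hk hfl
      exfalso
      have h1 := Int.abs_sub_lt_one_of_floor_eq_floor hfl
      rw [← mul_sub, abs_mul, abs_of_pos (by positivity : (0 : ℝ) < (k : ℝ) + 1)] at h1
      rw [div_le_iff₀ hpos] at hK
      have h2 : (K : ℝ) ≤ k := by exact_mod_cast hk
      nlinarith
  refine le_liminf_of_le (by isBoundedDefault) ?_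
  filter_upwards [hinj] with k hk
  calc (r : ENNReal) ≤ (m : ENNReal) := by exact_mod_cast hm
    _ = ∑ i ∈ F.image fun x => ⌊((k : ℝ) + 1) * x⌋, (1 : ENNReal) := by
        rw [Finset.sum_const, Finset.card_image_of_injOn (fun x hx y hy => hk x hx y hy), hFc]
        simp
    _ ≤ ∑ i ∈ F.image fun x => ⌊((k : ℝ) + 1) * x⌋, (A k i).indicator 1 X := by
        refine Finset.sum_le_sum fun i hi => ?_
        obtain ⟨x, hx, rfl⟩ := Finset.mem_image.1 hi
        rw [Set.indicator_of_mem]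
        · rfl
        · refine subset_toMeasurable _ _ ⟨point j x X, ⟨hF hx, ?_⟩, others_point j x X⟩
          simp [hT, coord_point]
    _ ≤ N k X := ENNReal.sum_le_tsum _

/-! ### Holomorphic functions along real coordinate lines -/

theorem continuous_point (j : RealIdx n) : Continuous fun p : Others j × ℝ => point j p.2 p.1 :=
  (pointEquiv j).continuous

theorem point_eq_add (j : RealIdx n) (t : ℝ) (X : Others j) :
    point j t X = point j 0 X + t • dir j := by
  rw [← point_add, zero_add]

/-- The derivative in the `j`-th real coordinate of a complex valued function. -/
def partialC (j : RealIdx n) (f : CSpace n → ℂ) (z : CSpace n) : ℂ := lineDeriv ℝ f z (dir j)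

theorem partialC_point (j : RealIdx n) (f : CSpace n → ℂ) (t : ℝ) (X : Others j) :
    partialC j f (point j t X) = deriv (fun s => f (point j s X)) t := by
  have h := deriv_comp_const_add (fun s => f (point j s X)) t 0
  rw [add_zero] at h
  rw [partialC, lineDeriv, ← h]
  simp only [point_add]

section Holomorphic

variable {W : Set (CSpace n)} {f : CSpace n → ℂ} (hW : IsOpen W) (hf : DifferentiableOn ℂ f W)
include hW hf

/-- The real line lies in the complex line spanned by `dir j`, on which `f` is holomorphic in one
variable. The real derivatives are its complex ones, so all regularity comes from one-variable
theory. -/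
theorem holomorphic_line (j : RealIdx n) (X : Others j) {t : ℝ} (ht : point j t X ∈ W) :
    HasDerivAt (fun s => f (point j s X)) (partialC j f (point j t X)) t ∧
    HasDerivAt (fun s => partialC j f (point j s X))
      (partialC j (partialC j f) (point j t X)) t ∧
    ContinuousAt (fun s => partialC j (partialC j f) (point j s X)) t := by
  set L : ℂ → CSpace n := fun ζ => point j 0 X + ζ • dir j with hL
  have hLr : ∀ s : ℝ, L s = point j s X := fun s => by
    rw [point_eq_add j s X, hL]
    simp
  have hLc : Continuous L := by fun_prop
  have hV : IsOpen (L ⁻¹' W) := hW.preimage hLc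
  have hd : DifferentiableOn ℂ (f ∘ L) (L ⁻¹' W) :=
    hf.comp (by fun_prop) (Set.mapsTo_preimage _ _)
  have h1 : DifferentiableOn ℂ (deriv (f ∘ L)) (L ⁻¹' W) := hd.deriv hV
  have h2 : DifferentiableOn ℂ (deriv (deriv (f ∘ L))) (L ⁻¹' W) := h1.deriv hV
  have hmem : ∀ s : ℝ, point j s X ∈ W → (s : ℂ) ∈ L ⁻¹' W := fun s hs => by
    rw [Set.mem_preimage, hLr]; exact hs
  have hopen : IsOpen {s : ℝ | point j s X ∈ W} :=
    hW.preimage ((continuous_point j).comp (Continuous.prodMk_right X))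
  have key : ∀ (k : CSpace n → ℂ) (K : ℂ → ℂ), DifferentiableOn ℂ K (L ⁻¹' W) →
      (∀ s : ℝ, point j s X ∈ W → k (point j s X) = K s) →
      ∀ s : ℝ, point j s X ∈ W → HasDerivAt (fun x => k (point j x X)) (deriv K s) s := by
    intro k K hK hk s hs
    have h := ((hK.differentiableAt (hV.mem_nhds (hmem s hs))).hasDerivAt).comp_ofReal
    refine h.congr_of_eventuallyEq ?_
    filter_upwards [hopen.mem_nhds hs] with x hx using hk x hx
  have k0 := key f (f ∘ L) hd (fun s _ => by simp [hLr])
  have e1 : ∀ s : ℝ, point j s X ∈ W → partialC j f (point j s X) = deriv (f ∘ L) s :=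
    fun s hs => by rw [partialC_point, (k0 s hs).deriv]
  have k1 := key (partialC j f) _ h1 e1
  have e2 : ∀ s : ℝ, point j s X ∈ W →
      partialC j (partialC j f) (point j s X) = deriv (deriv (f ∘ L)) s :=
    fun s hs => by rw [partialC_point, (k1 s hs).deriv]
  have k2 := key (partialC j (partialC j f)) _ h2 e2
  refine ⟨e1 t ht ▸ k0 t ht, e2 t ht ▸ k1 t ht, (k2 t ht).continuousAt⟩

theorem hasLineDerivAt_partialC (j : RealIdx n) {z : CSpace n} (hz : z ∈ W) :
    HasLineDerivAt ℝ f (partialC j f z) z (dir j) ∧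
    HasLineDerivAt ℝ (partialC j f) (partialC j (partialC j f) z) z (dir j) := by
  obtain ⟨h1, h2, -⟩ := holomorphic_line hW hf j (others j z) (t := coord j z)
    (by rwa [point_others])
  rw [point_others] at h1 h2
  rw [← add_zero (coord j z)] at h1 h2
  have h3 := h1.comp_const_add (coord j z) 0
  have h4 := h2.comp_const_add (coord j z) 0
  simp only [point_add, point_others] at h3 h4
  exact ⟨h3, h4⟩

theorem partialC_one (k : Fin n) {z : CSpace n} (hz : z ∈ W) :
    partialC (k, 1) f z = Complex.I * partialC (k, 0) f z := by
  have h : HasFDerivAt f ((fderiv ℂ f z).restrictScalars ℝ) z :=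
    ((hf.differentiableAt (hW.mem_nhds hz)).hasFDerivAt).restrictScalars ℝ
  rw [partialC, partialC, (h.hasLineDerivAt _).lineDeriv, (h.hasLineDerivAt _).lineDeriv, dir_one]
  simp

/-- Pointwise limit on `W` of difference quotients. Nothing is known of `f` off `W`, so it is
replaced there by zero, which does not affect small steps from a point of the open set `W`. -/
theorem aestronglyMeasurable_partialC (j : RealIdx n) :
    AEStronglyMeasurable (partialC j f) (volume.restrict W) := by
  classical
  set F : CSpace n → ℂ := W.piecewise f 0 with hF
  have hFm : Measurable F :=
    hf.continuousOn.measurable_piecewise continuousOn_const hW.measurableSet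
  have hFW : ∀ z ∈ W, F z = f z := fun z hz => Set.piecewise_eq_of_mem _ _ _ hz
  set s : ℕ → ℝ := fun m => 1 / ((m : ℝ) + 1) with hs
  refine aestronglyMeasurable_of_tendsto_ae (u := atTop)
    (f := fun (m : ℕ) z => (s m)⁻¹ • (F (z + s m • dir j) - F z)) (fun m => ?_) ?_
  · have h : Measurable fun z => F (z + s m • dir j) - F z :=
      (hFm.comp (measurable_add_const _)).sub hFm
    exact (h.const_smul (s m)⁻¹).aestronglyMeasurable
  · refine (ae_restrict_iff' hW.measurableSet).2 (ae_of_all _ fun z hz => ?_)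
    have h1 := (hasLineDerivAt_partialC hW hf j hz).1
    have hs0 : Tendsto s atTop (𝓝 0) := tendsto_one_div_add_atTop_nhds_zero_nat
    have hsn : Tendsto s atTop (𝓝[≠] 0) := by
      refine tendsto_nhdsWithin_of_tendsto_nhds_of_eventually_within _ hs0
        (Eventually.of_forall fun m => ?_)
      simp only [hs, Set.mem_compl_iff, Set.mem_singleton_iff]
      positivity
    have h2 := (hasDerivAt_iff_tendsto_slope_zero.1 h1).comp hsn
    refine h2.congr' ?_
    have hlim : Tendsto (fun m => z + s m • dir j) atTop (𝓝 z) := by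
      simpa using (hs0.smul_const (dir j)).const_add z
    filter_upwards [hlim (hW.mem_nhds hz)] with m hm
    simp [hFW z hz, hFW _ hm]

end Holomorphic

/-! ### Integration by parts across the exceptional set -/

/-- The function `t ↦ g (t, X)` does not have different one-sided limits at any point of
`E(X)`. -/
def NoJump (j : RealIdx n) (g : CSpace n → ℂ) (E : Set (CSpace n)) (X : Others j) : Prop :=
  ∀ x ∈ slice j E X, ∀ l r : ℂ, Tendsto (fun t => g (point j t X)) (𝓝[<] x) (𝓝 l) →
    Tendsto (fun t => g (point j t X)) (𝓝[>] x) (𝓝 r) → l = r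

theorem integral_fderiv_smul_eq (hn : 1 ≤ n) {W E : Set (CSpace n)} {f : CSpace n → ℂ}
    (hW : IsOpen W) (hf : DifferentiableOn ℂ f W) (hE : volume E = 0) (j : RealIdx n)
    {z₀ : CSpace n} {r : ℝ} (hr : 0 < r)
    (hWE : Metric.closedBall z₀ (2 * r) ⊆ W ∪ E)
    (hf0 : IntegrableOn f (Metric.closedBall z₀ (2 * r)))
    (hf2 : IntegrableOn (partialC j (partialC j f)) (Metric.closedBall z₀ (2 * r)))
    (hfin : ∀ᵐ X : Others j ∂μH[2 * (n : ℝ) - 1], (slice j E X).Finite)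
    (hj0 : ∀ᵐ X : Others j ∂μH[2 * (n : ℝ) - 1], NoJump j f E X)
    (hj1 : ∀ᵐ X : Others j ∂μH[2 * (n : ℝ) - 1], NoJump j (partialC j f) E X)
    {φ : CSpace n → ℝ} (hφ : ContDiff ℝ 1 φ) (hφs : tsupport φ ⊆ Metric.ball z₀ r) :
    ∫ z, fderiv ℝ φ z (dir j) • f z = -∫ z, φ z • partialC j f z := by
  have hHaar := isAddHaarMeasure_others hn j
  set μ : Measure (Others j) := μH[2 * (n : ℝ) - 1] with hμ
  obtain ⟨c, hc, hmap⟩ := exists_map_pointEquiv j μ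
  set Φ := pointEquiv j with hΦ
  set m := μ.prod (volume : Measure ℝ) with hm
  have hmp : MeasurePreserving Φ m (c • (volume : Measure (CSpace n))) :=
    ⟨Φ.continuous.measurable, hmap⟩
  have hemb : MeasurableEmbedding Φ := Φ.toHomeomorph.measurableEmbedding
  set K := Metric.closedBall z₀ (2 * r) with hK
  -- The cylinder `B × (a, b]` contains the ball of radius `r` carrying `φ` and lies in the ball of
  -- radius `2 * r` where the integrability hypotheses hold.
  set B := Metric.closedBall (others j z₀) r with hB
  set a := coord j z₀ - r with ha
  set b := coord j z₀ + r with hb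
  have hab : a < b := by rw [ha, hb]; linarith
  set I := Set.Ioc a b with hI
  have hQK : ∀ X ∈ B, ∀ t ∈ Set.Icc a b, point j t X ∈ K := by
    intro X hX t ht
    rw [hK, mem_closedBall_iff_norm]
    refine (norm_le_coord_add_others j _).trans ?_
    rw [others_sub, coord_sub, coord_point, others_point]
    have h1 := mem_closedBall_iff_norm.1 hX
    have h2 : |t - coord j z₀| ≤ r := abs_le.2 ⟨by linarith [ht.1], by linarith [ht.2]⟩
    linarith
  have hball : ∀ X t, point j t X ∈ Metric.ball z₀ r → X ∈ B ∧ t ∈ Set.Ioo a b := by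
    intro X t h
    rw [mem_ball_iff_norm] at h
    have h1 := (norm_others_le j _).trans_lt h
    have h2 := (abs_coord_le j _).trans_lt h
    rw [others_sub, others_point] at h1
    rw [coord_sub, coord_point] at h2
    have h3 := abs_lt.1 h2
    exact ⟨mem_closedBall_iff_norm.2 h1.le, by linarith [h3.1], by linarith [h3.2]⟩
  have hQm : (μ.restrict B).prod (volume.restrict I) = m.restrict (B ×ˢ I) :=
    Measure.prod_restrict _ _
  have hQsub : B ×ˢ I ⊆ Φ ⁻¹' K := fun p hp =>
    hQK p.1 hp.1 p.2 (Set.Ioc_subset_Icc_self hp.2)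
  have htrans : ∀ k : CSpace n → ℂ, IntegrableOn k K →
      Integrable (k ∘ Φ) ((μ.restrict B).prod (volume.restrict I)) := by
    intro k hk
    rw [hQm]
    have h1 : IntegrableOn k K (c • (volume : Measure (CSpace n))) := by
      rw [IntegrableOn, Measure.restrict_smul]
      exact hk.smul_measure_nnreal
    exact IntegrableOn.mono_set ((hmp.integrableOn_comp_preimage hemb).2 h1) hQsub
  have hi0 := htrans f hf0
  have hi2 := htrans _ hf2
  have hm1 : AEStronglyMeasurable (partialC j f ∘ Φ)
      ((μ.restrict B).prod (volume.restrict I)) := by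
    have h1 : AEStronglyMeasurable (partialC j f) ((volume : Measure (CSpace n)).restrict K) := by
      refine (aestronglyMeasurable_partialC hW hf j).mono_measure (Measure.restrict_mono' ?_ le_rfl)
      filter_upwards [measure_eq_zero_iff_ae_notMem.1 hE] with z hz hzK
      exact (hWE hzK).resolve_right hz
    have h2 : AEStronglyMeasurable (partialC j f)
        ((c • (volume : Measure (CSpace n))).restrict K) := by
      refine h1.mono_ac ?_
      rw [Measure.restrict_smul]
      exact Measure.smul_absolutelyContinuous
    have h3 := h2.comp_measurePreserving
      (hmp.restrict_preimage (Metric.isClosed_closedBall.measurableSet : MeasurableSet K))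
    rw [hQm]
    exact h3.mono_measure (Measure.restrict_mono hQsub le_rfl)
  have hline : ∀ᵐ X ∂μ.restrict B,
      IntervalIntegrable (fun t => partialC j f (point j t X)) volume a b ∧
      ∫ t in a..b, ‖partialC j f (point j t X)‖ ≤
        (b - a) * (∫ t in a..b, ‖partialC j (partialC j f) (point j t X)‖) +
          4 / (b - a) * ∫ t in a..b, ‖f (point j t X)‖ ∧
      ∀ φ φ' : ℝ → ℝ, (∀ t, HasDerivAt φ (φ' t) t) → Continuous φ' → φ a = 0 → φ b = 0 →
        ∫ t in a..b, φ' t • f (point j t X) = -∫ t in a..b, φ t • partialC j f (point j t X) := by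
    filter_upwards [ae_restrict_of_ae hfin, ae_restrict_of_ae hj0, ae_restrict_of_ae hj1,
      hi2.prod_right_ae,
      ae_restrict_mem (Metric.isClosed_closedBall.measurableSet : MeasurableSet B)]
      with X h1 h2 h3 h4 h5
    have hmem : ∀ t ∈ Set.Ioo a b \ slice j E X, point j t X ∈ W := fun t ht =>
      (hWE (hQK X h5 t (Set.Ioo_subset_Icc_self ht.1))).resolve_right ht.2
    exact interval_estimates hab h1
      (fun t ht => (holomorphic_line hW hf j X (hmem t ht)).1)
      (fun t ht => (holomorphic_line hW hf j X (hmem t ht)).2.1)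
      (fun t ht => (holomorphic_line hW hf j X (hmem t ht)).2.2.continuousWithinAt)
      ((intervalIntegrable_iff_integrableOn_Ioc_of_le hab.le).2 h4)
      (fun x hx => h2 x hx.1) (fun x hx => h3 x hx.1)
  -- The interpolation inequality dominates the linewise `L¹` norm by an integrable function of `X`;
  -- every line carries the same interval, so the constants are uniform.
  have hi1 : Integrable (partialC j f ∘ Φ) ((μ.restrict B).prod (volume.restrict I)) := by
    refine (integrable_prod_iff hm1).2 ⟨?_, ?_⟩
    · filter_upwards [hline] with X hX
      exact (intervalIntegrable_iff_integrableOn_Ioc_of_le hab.le).1 hX.1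
    · refine Integrable.mono' ((hi2.integral_norm_prod_left.const_mul (b - a)).add
        (hi0.integral_norm_prod_left.const_mul (4 / (b - a))))
        hm1.norm.integral_prod_right' ?_
      filter_upwards [hline] with X hX
      rw [Real.norm_of_nonneg (integral_nonneg fun _ => norm_nonneg _)]
      have h := hX.2.1
      simp only [intervalIntegral.integral_of_le hab.le] at h
      exact h
  have hcs : HasCompactSupport φ := by
    refine HasCompactSupport.of_support_subset_isCompact (isCompact_closedBall z₀ r)
      ((subset_tsupport φ).trans (hφs.trans Metric.ball_subset_closedBall))
  have hφ' : Continuous fun z => fderiv ℝ φ z (dir j) :=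
    (hφ.continuous_fderiv one_ne_zero).clm_apply continuous_const
  have hcs' : HasCompactSupport fun z => fderiv ℝ φ z (dir j) := hcs.fderiv_apply ℝ (dir j)
  have hint : ∀ (χ : CSpace n → ℝ) (k : CSpace n → ℂ), Continuous χ → HasCompactSupport χ →
      Integrable (k ∘ Φ) ((μ.restrict B).prod (volume.restrict I)) →
      Integrable (fun p => χ (Φ p) • k (Φ p)) ((μ.restrict B).prod (volume.restrict I)) := by
    intro χ k hχ hχs hk
    obtain ⟨C, hC⟩ := hχs.exists_bound_of_continuous hχ
    exact hk.bdd_smul C (hχ.comp Φ.continuous).aestronglyMeasurable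
      (ae_of_all _ fun p => hC (Φ p))
  have hto : ∀ (χ : CSpace n → ℝ) (k : CSpace n → ℂ), Function.support χ ⊆ Metric.ball z₀ r →
      ∫ p, χ (Φ p) • k (Φ p) ∂((μ.restrict B).prod (volume.restrict I)) =
        c • ∫ z, χ z • k z := by
    intro χ k hχ
    rw [hQm, setIntegral_eq_integral_of_forall_compl_eq_zero,
      hmp.integral_comp hemb (fun z => χ z • k z), integral_smul_nnreal_measure]
    intro p hp
    have : Φ p ∉ Function.support χ := fun h => hp (by
      have := hball p.1 p.2 (hχ h)
      exact ⟨this.1, Set.Ioo_subset_Ioc_self this.2⟩)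
    rw [Function.notMem_support.1 this, zero_smul]
  have hs' : Function.support (fun z => fderiv ℝ φ z (dir j)) ⊆ Metric.ball z₀ r := by
    refine Set.Subset.trans ?_ hφs
    intro z hz
    refine support_fderiv_subset ℝ ?_
    exact fun h => hz (by simp [h])
  have h1 := hto _ f hs'
  have h2 := hto φ (partialC j f) ((subset_tsupport φ).trans hφs)
  rw [integral_prod _ (hint _ f hφ' hcs' hi0)] at h1
  rw [integral_prod _ (hint _ _ hφ.continuous hcs hi1)] at h2
  have h3 : ∫ X, ∫ t, fderiv ℝ φ (Φ (X, t)) (dir j) • f (Φ (X, t)) ∂volume.restrict I ∂μ.restrict B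
      = -∫ X, ∫ t, φ (Φ (X, t)) • partialC j f (Φ (X, t)) ∂volume.restrict I ∂μ.restrict B := by
    rw [← integral_neg]
    refine integral_congr_ae ?_
    filter_upwards [hline] with X hX
    have hout : ∀ t, t ∉ Set.Ioo a b → φ (point j t X) = 0 := fun t ht => by
      by_contra h
      exact ht (hball X t (hφs (subset_tsupport φ h))).2
    have h4 := hX.2.2 (fun t => φ (point j t X)) (fun t => fderiv ℝ φ (point j t X) (dir j))
      (fun t => by
        have e1 : HasDerivAt (fun s : ℝ => point j s X) (dir j) t := by
          have : (fun s : ℝ => point j s X) = fun s => point j 0 X + s • dir j :=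
            funext fun s => point_eq_add j s X
          rw [this]
          simpa using ((hasDerivAt_id t).smul_const (dir j)).const_add (point j 0 X)
        exact ((hφ.differentiable one_ne_zero _).hasFDerivAt).comp_hasDerivAt t e1)
      (hφ'.comp ((continuous_point j).comp (Continuous.prodMk_right X)))
      (hout a fun h => lt_irrefl _ h.1) (hout b fun h => lt_irrefl _ h.2)
    simp only [intervalIntegral.integral_of_le hab.le] at h4
    exact h4
  rw [h1, h2, ← smul_neg] at h3
  exact smul_right_injective _ hc h3

/-! ### Mollification and weak solutions of the Cauchy-Riemann equations -/

open ContinuousLinearMap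
open scoped Convolution

/-- An unnormalized smooth bump on the ball of radius `ε`, invariant under rotations. -/
def bump (n : ℕ) (ε : ℝ) (w : CSpace n) : ℝ := Real.smoothTransition (ε ^ 2 - ‖w‖ ^ 2)

/-- A rotation invariant smooth mollifier with support in the ball of radius `ε`. -/
def mollifier (n : ℕ) (ε : ℝ) (w : CSpace n) : ℝ := (∫ z, bump n ε z)⁻¹ * bump n ε w

theorem contDiff_bump (ε : ℝ) : ContDiff ℝ 1 (bump n ε) := by
  have h : ContDiff ℝ ((1 : ℕ∞) : WithTop ℕ∞) (Real.smoothTransition) :=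
    Real.smoothTransition.contDiff
  exact h.comp (contDiff_const.sub (contDiff_norm_sq ℝ))

theorem support_bump {ε : ℝ} (hε : 0 < ε) : Function.support (bump n ε) = Metric.ball 0 ε := by
  ext w
  rw [Function.mem_support, bump, Ne, Real.smoothTransition.zero_iff_nonpos, mem_ball_zero_iff,
    not_le, sub_pos, sq_lt_sq₀ (norm_nonneg _) hε.le]

theorem hasCompactSupport_bump {ε : ℝ} (hε : 0 < ε) : HasCompactSupport (bump n ε) :=
  HasCompactSupport.of_support_subset_isCompact (isCompact_closedBall 0 ε)
    ((support_bump hε).trans_subset Metric.ball_subset_closedBall)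

theorem integral_bump_pos {ε : ℝ} (hε : 0 < ε) : 0 < ∫ z, bump n ε z := by
  refine (integral_pos_iff_support_of_nonneg (fun w => Real.smoothTransition.nonneg _)
    ((contDiff_bump ε).continuous.integrable_of_hasCompactSupport (hasCompactSupport_bump hε))).2 ?_
  change 0 < volume (Function.support (bump n ε))
  rw [support_bump hε]
  exact Metric.measure_ball_pos _ _ hε

theorem contDiff_mollifier (ε : ℝ) : ContDiff ℝ 1 (mollifier n ε) :=
  contDiff_const.mul (contDiff_bump ε)

theorem mollifier_nonneg {ε : ℝ} (hε : 0 < ε) (w : CSpace n) : 0 ≤ mollifier n ε w :=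
  mul_nonneg (inv_nonneg.2 (integral_bump_pos hε).le) (Real.smoothTransition.nonneg _)

theorem support_mollifier {ε : ℝ} (hε : 0 < ε) :
    Function.support (mollifier n ε) = Metric.ball 0 ε := by
  rw [← support_bump hε]
  exact Function.support_const_smul_of_ne_zero _ _ (inv_ne_zero (integral_bump_pos hε).ne')

theorem hasCompactSupport_mollifier {ε : ℝ} (hε : 0 < ε) : HasCompactSupport (mollifier n ε) :=
  HasCompactSupport.of_support_subset_isCompact (isCompact_closedBall 0 ε)
    ((support_mollifier hε).trans_subset Metric.ball_subset_closedBall)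

theorem integral_mollifier {ε : ℝ} (hε : 0 < ε) : ∫ w, mollifier n ε w = 1 := by
  simp only [mollifier]
  rw [integral_const_mul, inv_mul_cancel₀ (integral_bump_pos hε).ne']

theorem integrable_mollifier {ε : ℝ} (hε : 0 < ε) : Integrable (mollifier n ε) :=
  integrable_of_integral_eq_one (integral_mollifier hε)

theorem mollifier_smul (ε : ℝ) {c : ℂ} (hc : ‖c‖ = 1) (w : CSpace n) :
    mollifier n ε (c • w) = mollifier n ε w := by
  simp [mollifier, bump, norm_smul, hc]

/-- Two real linear functionals on `ℂⁿ` that agree on the coordinate directions are equal. -/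
theorem linearMap_ext_dir {A B : CSpace n →ₗ[ℝ] ℂ} (h : ∀ j, A (dir j) = B (dir j)) : A = B := by
  ext v
  have hv : v = ∑ j, coord j v • dir j := by
    refine ext_coord fun i => ?_
    have h1 : coord i (∑ j, coord j v • dir j) = ∑ j, coord i (coord j v • dir j) :=
      map_sum ((LinearMap.snd ℝ (Others i) ℝ).comp
        (pointEquiv i).symm.toLinearEquiv.toLinearMap) _ _
    rw [h1]
    simp [coord_smul, coord_dir]
  rw [hv, map_sum, map_sum]
  exact Finset.sum_congr rfl fun j _ => by rw [map_smul, map_smul, h]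

/-- A real differentiable function satisfying the Cauchy-Riemann equations is complex
differentiable. -/
theorem differentiableAt_of_cauchyRiemann {F : CSpace n → ℂ} {D : CSpace n →L[ℝ] ℂ}
    {z : CSpace n} (hF : HasFDerivAt F D z)
    (h : ∀ k, D (dir (k, 1)) = Complex.I * D (dir (k, 0))) : DifferentiableAt ℂ F z := by
  set A : CSpace n →ₗ[ℝ] ℂ :=
    { toFun := fun v => D (Complex.I • v)
      map_add' := fun v w => by rw [smul_add, map_add]
      map_smul' := fun c v => by rw [smul_comm, map_smul]; rfl }
  set B : CSpace n →ₗ[ℝ] ℂ :=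
    { toFun := fun v => Complex.I * D v
      map_add' := fun v w => by rw [map_add, mul_add]
      map_smul' := fun c v => by simp; ring }
  have hAB : A = B := by
    refine linearMap_ext_dir fun j => ?_
    obtain ⟨k, i⟩ := j
    fin_cases i
    · change D (Complex.I • dir (k, 0)) = Complex.I * D (dir (k, 0))
      rw [← dir_one, h]
    · change D (Complex.I • dir (k, 1)) = Complex.I * D (dir (k, 1))
      rw [h, dir_one, smul_smul, ← mul_assoc, Complex.I_mul_I, neg_one_smul, map_neg, neg_one_mul]
  have hI : ∀ v, D (Complex.I • v) = Complex.I * D v := fun v => LinearMap.congr_fun hAB v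
  let D' : CSpace n →L[ℂ] ℂ :=
    { toFun := D
      map_add' := D.map_add
      map_smul' := fun c v => by
        have hc : c • v = c.re • v + c.im • (Complex.I • v) := by
          conv_lhs => rw [← Complex.re_add_im c]
          rw [add_smul, mul_smul]
          rfl
        rw [hc, map_add, map_smul, map_smul, hI]
        conv_rhs => rw [RingHom.id_apply, ← Complex.re_add_im c]
        simp only [Complex.real_smul, smul_eq_mul]
        ring
      cont := D.continuous }
  exact (hasFDerivAt_of_restrictScalars ℝ (f' := D') hF rfl).differentiableAt

/-- A weak solution of the Cauchy-Riemann equations becomes holomorphic after mollification. -/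
theorem differentiableAt_mollify {f : CSpace n → ℂ} (hf : Integrable f) {z₀ : CSpace n} {r : ℝ}
    (hCR : ∀ φ : CSpace n → ℝ, ContDiff ℝ 1 φ → tsupport φ ⊆ Metric.ball z₀ r → ∀ k,
      ∫ w, fderiv ℝ φ w (dir (k, 1)) • f w = Complex.I * ∫ w, fderiv ℝ φ w (dir (k, 0)) • f w)
    {ε : ℝ} (hε : 0 < ε) {z : CSpace n} (hz : Metric.closedBall z ε ⊆ Metric.ball z₀ r) :
    DifferentiableAt ℂ (mollifier n ε ⋆[lsmul ℝ ℝ, volume] f) z := by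
  set ρ := mollifier n ε with hρ
  have hρc : ContDiff ℝ 1 ρ := contDiff_mollifier ε
  have hcs : HasCompactSupport ρ := hasCompactSupport_mollifier hε
  have hD := hcs.hasFDerivAt_convolution_left (lsmul ℝ ℝ) hρc hf.locallyIntegrable z (μ := volume)
  -- The derivative of the mollification at `z` is, up to sign, `f` tested against the derivative of
  -- `y ↦ ρ (z - y)`, so the weak equations become pointwise ones.
  have hDv : ∀ v, (fderiv ℝ ρ ⋆[(lsmul ℝ ℝ : ℝ →L[ℝ] ℂ →L[ℝ] ℂ).precompL (CSpace n), volume] f) z v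
      = -∫ w, fderiv ℝ (fun y => ρ (z - y)) w v • f w := by
    intro v
    have hex := (hcs.fderiv ℝ).convolutionExists_left
      ((lsmul ℝ ℝ : ℝ →L[ℝ] ℂ →L[ℝ] ℂ).precompL (CSpace n))
      (hρc.continuous_fderiv one_ne_zero) hf.locallyIntegrable z
    rw [convolution_def, ContinuousLinearMap.integral_apply hex, ← integral_neg,
      ← integral_sub_left_eq_self _ volume z]
    refine integral_congr_ae (ae_of_all _ fun w => ?_)
    have h1 : HasFDerivAt (fun y => ρ (z - y)) (-(fderiv ℝ ρ (z - w))) w := by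
      have h2 := (hρc.differentiable one_ne_zero (z - w)).hasFDerivAt.comp w
        ((hasFDerivAt_id w).const_sub z)
      refine h2.congr_fderiv ?_
      ext v
      simp
    simp only [h1.fderiv]
    simp
  refine differentiableAt_of_cauchyRiemann hD fun k => ?_
  rw [hDv, hDv, hCR (fun y => ρ (z - y)) (hρc.comp (contDiff_const.sub contDiff_id)), mul_neg]
  refine subset_trans ?_ hz
  refine closure_minimal ?_ Metric.isClosed_closedBall
  intro y hy
  have h1 : z - y ∈ Function.support ρ := hy
  rw [hρ, support_mollifier hε, mem_ball_zero_iff] at h1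
  rw [mem_closedBall_iff_norm, norm_sub_rev]
  exact h1.le

/-- The mean value property with respect to a rotation invariant mollifier. -/
theorem mollify_eq_self {g : CSpace n → ℂ} (hg : Continuous g) {ε : ℝ} (hε : 0 < ε)
    {z : CSpace n} (hd : ∀ w ∈ Metric.ball z ε, DifferentiableAt ℂ g w) :
    (mollifier n ε ⋆[lsmul ℝ ℝ, volume] g) z = g z := by
  set ρ := mollifier n ε with hρ
  have hρc : Continuous ρ := (contDiff_mollifier ε).continuous
  have hsupp : ∀ w, ρ w ≠ 0 → ‖w‖ < ε := fun w hw => by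
    have : w ∈ Function.support ρ := hw
    rwa [hρ, support_mollifier hε, mem_ball_zero_iff] at this
  -- Multiplication by a unit complex number is an isometry of `ℂⁿ` preserving both `ρ` and the
  -- volume, so the convolution may be averaged over `θ`.
  have hrot : ∀ θ : ℝ, ∫ w, ρ w • g (z - circleMap 0 1 θ • w) = ∫ w, ρ w • g (z - w) := by
    intro θ
    have hc : ‖circleMap 0 1 θ‖ = 1 := by simp
    have hc0 : circleMap 0 1 θ ≠ 0 := by
      intro h; rw [h, norm_zero] at hc; exact zero_ne_one hc
    let e : CSpace n ≃ₗᵢ[ℝ] CSpace n :=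
      { toLinearEquiv := (LinearEquiv.smulOfNeZero ℂ (CSpace n) _ hc0).restrictScalars ℝ
        norm_map' := fun w => by
          change ‖circleMap 0 1 θ • w‖ = ‖w‖
          rw [norm_smul, hc, one_mul] }
    have h1 := e.measurePreserving.integral_comp e.toHomeomorph.measurableEmbedding
      (fun w => ρ w • g (z - w))
    rw [← h1]
    refine integral_congr_ae (ae_of_all _ fun w => ?_)
    change ρ w • g (z - circleMap 0 1 θ • w) =
      ρ (circleMap 0 1 θ • w) • g (z - circleMap 0 1 θ • w)
    rw [hρ, mollifier_smul ε hc]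
  -- For fixed `w` this is the one-variable mean value property on the disc `ζ ↦ z - ζ • w`, which
  -- stays in the ball where `g` is holomorphic.
  have hmean : ∀ w, ρ w ≠ 0 →
      ∫ θ in (0 : ℝ)..2 * Real.pi, g (z - circleMap 0 1 θ • w) = (2 * Real.pi) • g z := by
    intro w hw
    have hdc : DiffContOnCl ℂ (fun ζ : ℂ => g (z - ζ • w)) (Metric.ball 0 |1|) := by
      refine DifferentiableOn.diffContOnCl ?_
      rw [abs_one, closure_ball _ one_ne_zero]
      intro ζ hζ
      refine DifferentiableAt.differentiableWithinAt ?_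
      refine DifferentiableAt.comp (g := g) (f := fun ζ : ℂ => z - ζ • w) ζ (hd _ ?_)
        (by fun_prop)
      rw [mem_ball_iff_norm, sub_sub_cancel_left, norm_neg, norm_smul]
      rw [mem_closedBall_zero_iff] at hζ
      exact (mul_le_of_le_one_left (norm_nonneg _) hζ).trans_lt (hsupp w hw)
    have h := hdc.circleAverage
    rw [Real.circleAverage_def] at h
    simp only [zero_smul, sub_zero] at h
    rw [← h, smul_smul, mul_inv_cancel₀ (by positivity), one_smul]
  obtain ⟨M, hM⟩ := (isCompact_closedBall z ε).exists_bound_of_continuousOn hg.continuousOn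
  have hint : Integrable (Function.uncurry fun (θ : ℝ) (w : CSpace n) =>
      ρ w • g (z - circleMap 0 1 θ • w))
      ((volume.restrict (Set.Ioc 0 (2 * Real.pi))).prod volume) := by
    refine Integrable.mono' (((integrable_mollifier hε).mul_const M).comp_snd
      (volume.restrict (Set.Ioc 0 (2 * Real.pi)))) ?_ (ae_of_all _ ?_)
    · refine Continuous.aestronglyMeasurable ?_
      have h1 : Continuous fun p : ℝ × CSpace n => circleMap 0 1 p.1 :=
        (continuous_circleMap 0 1).comp continuous_fst
      exact (hρc.comp continuous_snd).smul
        (hg.comp (continuous_const.sub (h1.smul continuous_snd)))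
    · rintro ⟨θ, w⟩
      change ‖ρ w • g (z - circleMap 0 1 θ • w)‖ ≤ ρ w * M
      rw [norm_smul, Real.norm_of_nonneg (mollifier_nonneg hε w), ← hρ]
      by_cases hw : ρ w = 0
      · simp [hw]
      · refine mul_le_mul_of_nonneg_left (hM _ ?_) (mollifier_nonneg hε w)
        rw [mem_closedBall_iff_norm, sub_sub_cancel_left, norm_neg, norm_smul]
        simpa using (hsupp w hw).le
  have hswap := integral_integral_swap hint
  have h1 : ∫ θ in Set.Ioc 0 (2 * Real.pi), ∫ w, ρ w • g (z - circleMap 0 1 θ • w) =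
      (2 * Real.pi) • ∫ w, ρ w • g (z - w) := by
    simp_rw [hrot]
    rw [setIntegral_const]
    simp [Real.pi_pos.le]
  have h2 : ∫ w, ∫ θ in Set.Ioc 0 (2 * Real.pi), ρ w • g (z - circleMap 0 1 θ • w) =
      (2 * Real.pi) • g z := by
    have h3 : ∀ w, ∫ θ in Set.Ioc 0 (2 * Real.pi), ρ w • g (z - circleMap 0 1 θ • w) =
        ρ w • (2 * Real.pi) • g z := by
      intro w
      rw [integral_smul]
      by_cases hw : ρ w = 0
      · simp [hw]
      · rw [← intervalIntegral.integral_of_le (by positivity), hmean w hw]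
    simp_rw [h3]
    rw [integral_smul_const, integral_mollifier hε, one_smul]
  rw [h1, h2] at hswap
  rw [convolution_def]
  exact smul_right_injective ℂ (by positivity : (2 * Real.pi) ≠ 0) hswap

/-- By associativity each side convolves `f` with the product of the two kernels, and convolution of
scalar kernels is commutative. -/
theorem mollify_comm {f : CSpace n → ℂ} (hf : Integrable f) {ε δ : ℝ} (hε : 0 < ε) (hδ : 0 < δ) :
    mollifier n ε ⋆[lsmul ℝ ℝ, volume] (mollifier n δ ⋆[lsmul ℝ ℝ, volume] f) =
      mollifier n δ ⋆[lsmul ℝ ℝ, volume] (mollifier n ε ⋆[lsmul ℝ ℝ, volume] f) := by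
  have key : ∀ {ε δ : ℝ}, 0 < ε → 0 < δ →
      (mollifier n ε ⋆[mul ℝ ℝ, volume] mollifier n δ) ⋆[lsmul ℝ ℝ, volume] f =
      mollifier n ε ⋆[lsmul ℝ ℝ, volume] (mollifier n δ ⋆[lsmul ℝ ℝ, volume] f) := by
    intro ε δ hε hδ
    have cε := (contDiff_mollifier (n := n) ε).continuous
    have cδ := (contDiff_mollifier (n := n) δ).continuous
    have sε := hasCompactSupport_mollifier (n := n) hε
    have sδ := hasCompactSupport_mollifier (n := n) hδ
    ext z
    refine convolution_assoc (mul ℝ ℝ) (lsmul ℝ ℝ) (lsmul ℝ ℝ) (lsmul ℝ ℝ)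
      (fun x y z => by simp [mul_assoc]) cε.aestronglyMeasurable cδ.aestronglyMeasurable
      hf.aestronglyMeasurable ?_ ?_ ?_
    · exact ae_of_all _ (sε.convolutionExists_left _ cε cδ.locallyIntegrable)
    · exact ae_of_all _ (sδ.norm.convolutionExists_left _ cδ.norm hf.norm.locallyIntegrable)
    · exact sε.norm.convolutionExists_left _ cε.norm
        (sδ.norm.continuous_convolution_left _ cδ.norm hf.norm.locallyIntegrable).locallyIntegrable
        z
  rw [← key hε hδ, ← key hδ hε]
  congr 1
  rw [← convolution_flip]
  congr 1
  ext
  simp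

/-- Weak solutions of the Cauchy-Riemann equations are holomorphic. -/
theorem exists_holomorphic_of_weak {f : CSpace n → ℂ} (hf : Integrable f) {z₀ : CSpace n} {r : ℝ}
    (hr : 0 < r)
    (hCR : ∀ φ : CSpace n → ℝ, ContDiff ℝ 1 φ → tsupport φ ⊆ Metric.ball z₀ r → ∀ k,
      ∫ w, fderiv ℝ φ w (dir (k, 1)) • f w =
        Complex.I * ∫ w, fderiv ℝ φ w (dir (k, 0)) • f w) :
    ∃ F : CSpace n → ℂ, DifferentiableOn ℂ F (Metric.ball z₀ (r / 4)) ∧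
      ∀ z ∈ Metric.ball z₀ (r / 4), ContinuousAt f z → F z = f z := by
  set m : ℝ → CSpace n → ℂ := fun ε => mollifier n ε ⋆[lsmul ℝ ℝ, volume] f with hm
  have hr4 : 0 < r / 4 := by positivity
  have hdiff : ∀ ε, 0 < ε → ε ≤ r / 4 → ∀ z ∈ Metric.ball z₀ (r / 2),
      DifferentiableAt ℂ (m ε) z := by
    intro ε hε hεr z hz
    refine differentiableAt_mollify hf hCR hε fun w hw => ?_
    rw [Metric.mem_ball] at hz ⊢
    rw [Metric.mem_closedBall] at hw
    linarith [dist_triangle w z z₀]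
  have hcont : ∀ ε, 0 < ε → Continuous (m ε) := fun ε hε =>
    (hasCompactSupport_mollifier hε).continuous_convolution_left _
      (contDiff_mollifier ε).continuous hf.locallyIntegrable
  have hmean : ∀ ε δ, 0 < ε → ε ≤ r / 4 → 0 < δ → δ ≤ r / 4 → ∀ z ∈ Metric.ball z₀ (r / 4),
      (mollifier n δ ⋆[lsmul ℝ ℝ, volume] m ε) z = m ε z := by
    intro ε δ hε hεr hδ hδr z hz
    refine mollify_eq_self (hcont ε hε) hδ fun w hw => hdiff ε hε hεr w ?_
    rw [Metric.mem_ball] at *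
    linarith [dist_triangle w z z₀]
  -- Mollifying twice, with radii `ε` and `r / 4` in either order, gives the same function. The mean
  -- value property strips off the outer mollification each time, so the result is independent of
  -- `ε`.
  have heq : ∀ ε, 0 < ε → ε ≤ r / 4 → ∀ z ∈ Metric.ball z₀ (r / 4), m (r / 4) z = m ε z := by
    intro ε hε hεr z hz
    rw [← hmean (r / 4) ε hr4 le_rfl hε hεr z hz, ← hmean ε (r / 4) hε hεr hr4 le_rfl z hz,
      hm]
    exact congrFun (mollify_comm hf hε hr4) z
  refine ⟨m (r / 4), fun z hz => (hdiff _ hr4 le_rfl z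
    (Metric.ball_subset_ball (by linarith) hz)).differentiableWithinAt, fun z hz hc => ?_⟩
  -- Shrinking `ε` leaves the value at `z` unchanged, while at a continuity point the averages
  -- approach `f z`.
  refine eq_of_forall_dist_le fun η hη => ?_
  obtain ⟨δ, hδ, hball⟩ := Metric.continuousAt_iff.1 hc η hη
  have hpos : 0 < min δ (r / 4) := lt_min hδ hr4
  rw [heq _ hpos (min_le_right _ _) z hz]
  exact dist_convolution_le hη.le (support_mollifier hpos).subset
    (mollifier_nonneg hpos) (integral_mollifier hpos) hf.aestronglyMeasurable
    fun x hx => (hball (lt_of_lt_of_le (Metric.mem_ball.1 hx) (min_le_left _ _))).le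

/-! ### From the hypotheses on `u` and `v` to statements about `f` -/

section Slopes

variable {W : Set (CSpace n)} {f : CSpace n → ℂ} (hW : IsOpen W) (hf : DifferentiableOn ℂ f W)
include hW hf

theorem partialDeriv_comp (T : ℂ →L[ℝ] ℝ) (j : RealIdx n) {z : CSpace n} (hz : z ∈ W) :
    partialDeriv j (fun w => T (f w)) z = T (partialC j f z) ∧
    partialDeriv j (partialDeriv j fun w => T (f w)) z = T (partialC j (partialC j f) z) := by
  have h1 : ∀ w ∈ W, partialDeriv j (fun w => T (f w)) w = T (partialC j f w) := fun w hw =>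
    HasLineDerivAt.lineDeriv
      (T.hasFDerivAt.comp_hasDerivAt 0 (hasLineDerivAt_partialC hW hf j hw).1)
  refine ⟨h1 z hz, ?_⟩
  have h2 : HasLineDerivAt ℝ (fun w => T (partialC j f w)) (T (partialC j (partialC j f) z)) z
      (dir j) :=
    T.hasFDerivAt.comp_hasDerivAt 0 (hasLineDerivAt_partialC hW hf j hz).2
  refine HasLineDerivAt.lineDeriv (h2.congr_of_eventuallyEq ?_)
  filter_upwards [hW.mem_nhds hz] with w hw using h1 w hw

/-- Once the derivatives converge along the sequences, the lower and upper limits are genuine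
limits. `T` stands for the real or the imaginary part. -/
theorem eq_of_matchingSlopes (T : ℂ →L[ℝ] ℝ) (j : RealIdx n) {X : Others j} {a b : ℕ → ℝ}
    (ha : ∀ l, point j (a l) X ∈ W) (hb : ∀ l, point j (b l) X ∈ W)
    (hm : MatchingSlopes j (fun w => T (f w)) X a b) {p q : ℂ}
    (hp : Tendsto (fun l => partialC j f (point j (a l) X)) atTop (𝓝 p))
    (hq : Tendsto (fun l => partialC j f (point j (b l) X)) atTop (𝓝 q)) : T p = T q := by
  obtain ⟨s, h1, h2⟩ := hm
  have hc : Continuous fun w : ℂ => (T w : EReal) := continuous_coe_real_ereal.comp T.continuous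
  have hp' := (hc.tendsto p).comp hp
  have hq' := (hc.tendsto q).comp hq
  have h3 : ∀ l, partialDeriv j (fun w => T (f w)) (point j (a l) X) =
      T (partialC j f (point j (a l) X)) := fun l => (partialDeriv_comp hW hf T j (ha l)).1
  have h4 : ∀ l, partialDeriv j (fun w => T (f w)) (point j (b l) X) =
      T (partialC j f (point j (b l) X)) := fun l => (partialDeriv_comp hW hf T j (hb l)).1
  simp only [h3] at h1
  simp only [h4] at h2
  have h5 := hp'.liminf_eq.symm.trans h1
  have h6 := hq'.limsup_eq.symm.trans h2
  exact EReal.coe_injective (h5.trans h6.symm)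

end Slopes

theorem tendsto_nhdsLT_of_monotone {a : ℕ → ℝ} {x : ℝ} (ha : Monotone a)
    (hx : Tendsto a atTop (𝓝 x)) (hne : ∀ l, a l ≠ x) : Tendsto a atTop (𝓝[<] x) :=
  tendsto_nhdsWithin_of_tendsto_nhds_of_eventually_within _ hx
    (Eventually.of_forall fun l => lt_of_le_of_ne (ha.ge_of_tendsto hx l) (hne l))

theorem tendsto_nhdsGT_of_antitone {b : ℕ → ℝ} {x : ℝ} (hb : Antitone b)
    (hx : Tendsto b atTop (𝓝 x)) (hne : ∀ l, b l ≠ x) : Tendsto b atTop (𝓝[>] x) :=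
  tendsto_nhdsWithin_of_tendsto_nhds_of_eventually_within _ hx
    (Eventually.of_forall fun l => lt_of_le_of_ne (hb.le_of_tendsto hx l) (hne l).symm)

/-- One-sided limits, when they exist, can be computed along the given sequences. These avoid `x₀`,
since they run outside `E`, so monotonicity places them strictly on the proper side. -/
theorem noJump_of_matching {Ω E : Set (CSpace n)} {f : CSpace n → ℂ} (hW : IsOpen (Ω \ E))
    (hf : DifferentiableOn ℂ f (Ω \ E)) (j : RealIdx n) {X : Others j}
    (h : ∀ x₀ ∈ slice j E X, ∃ a b : ℕ → ℝ,
      (∀ l, a l ∈ slice j (Ω \ E) X) ∧ (∀ l, b l ∈ slice j (Ω \ E) X) ∧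
      Monotone a ∧ Tendsto a atTop (𝓝 x₀) ∧ Antitone b ∧ Tendsto b atTop (𝓝 x₀) ∧
      (∃ c : ℂ, Tendsto (fun l => f (point j (a l) X)) atTop (𝓝 c) ∧
        Tendsto (fun l => f (point j (b l) X)) atTop (𝓝 c)) ∧
      MatchingSlopes j (fun z => (f z).re) X a b ∧ MatchingSlopes j (fun z => (f z).im) X a b) :
    NoJump j f E X ∧ NoJump j (partialC j f) E X := by
  refine ⟨fun x hx l r hl hr => ?_, fun x hx l r hl hr => ?_⟩
  all_goals
    obtain ⟨a, b, ha, hb, ham, hax, hbm, hbx, ⟨c, hca, hcb⟩, hu, hv⟩ := h x hx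
    have ha' := hl.comp (tendsto_nhdsLT_of_monotone ham hax fun k hk => (ha k).2 (hk ▸ hx))
    have hb' := hr.comp (tendsto_nhdsGT_of_antitone hbm hbx fun k hk => (hb k).2 (hk ▸ hx))
  · rw [tendsto_nhds_unique ha' hca, tendsto_nhds_unique hb' hcb]
  · exact Complex.ext (eq_of_matchingSlopes hW hf Complex.reCLM j ha hb hu ha' hb')
      (eq_of_matchingSlopes hW hf Complex.imCLM j ha hb hv ha' hb')

theorem L1loc.integrableOn_of_isCompact {F : Type*} [NormedAddCommGroup F] {g : CSpace n → F}
    {Ω E K : Set (CSpace n)} (hg : L1loc g Ω E) (hE : volume E = 0)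
    (hK : IsCompact K) (hKΩ : K ⊆ Ω) : IntegrableOn g K := by
  have h := hg.integrableOn_compact_subset hKΩ hK
  rw [IntegrableOn, Measure.restrict_restrict hK.measurableSet] at h
  refine IntegrableOn.congr_set_ae h ?_
  filter_upwards [measure_eq_zero_iff_ae_notMem.1 hE] with z hz
  exact propext ⟨fun hzK => ⟨hzK, hKΩ hzK, hz⟩, fun h => h.1⟩

theorem integrableOn_partialC {Ω E K : Set (CSpace n)} {f : CSpace n → ℂ}
    (hW : IsOpen (Ω \ E)) (hf : DifferentiableOn ℂ f (Ω \ E)) (hE : volume E = 0)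
    (j : RealIdx n)
    (hu : L1loc (partialDeriv j (partialDeriv j fun z => (f z).re)) Ω E)
    (hv : L1loc (partialDeriv j (partialDeriv j fun z => (f z).im)) Ω E)
    (hK : IsCompact K) (hKΩ : K ⊆ Ω) : IntegrableOn (partialC j (partialC j f)) K := by
  have h1 := hu.integrableOn_of_isCompact hE hK hKΩ
  have h2 := hv.integrableOn_of_isCompact hE hK hKΩ
  refine Integrable.congr (h1.ofReal.add (h2.ofReal.mul_const Complex.I)) ?_
  filter_upwards [ae_restrict_of_ae (measure_eq_zero_iff_ae_notMem.1 hE),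
    ae_restrict_mem hK.measurableSet] with z hz hzK
  have e1 := (partialDeriv_comp hW hf Complex.reCLM j (z := z) ⟨hKΩ hzK, hz⟩).2
  have e2 := (partialDeriv_comp hW hf Complex.imCLM j (z := z) ⟨hKΩ hzK, hz⟩).2
  simp only [Complex.reCLM_apply, Complex.imCLM_apply] at e1 e2
  simp only [Pi.add_apply, e1, e2]
  exact Complex.re_add_im _

end HolExt

end

/-! ### Local extension and gluing -/

open HolExt in
theorem theorem4 (n : ℕ) (hn : 1 ≤ n) (Ω E : Set (HolExt.CSpace n))
    (hΩ : IsOpen Ω) (hΩc : IsConnected Ω)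
    (hEΩ : E ⊆ Ω) (hE : IsClosed ((↑) ⁻¹' E : Set Ω))
    (hEH : μH[2 * (n : ℝ) - 1] E < ⊤)
    (f : HolExt.CSpace n → ℂ) (hf : DifferentiableOn ℂ f (Ω \ E))
    (u v : HolExt.CSpace n → ℝ) (hu : u = fun z => (f z).re) (hv : v = fun z => (f z).im)
    (hf1 : HolExt.L1loc f Ω E)
    (hu2 : ∀ j : HolExt.RealIdx n,
      HolExt.L1loc (HolExt.partialDeriv j (HolExt.partialDeriv j u)) Ω E)
    (hv2 : ∀ j : HolExt.RealIdx n,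
      HolExt.L1loc (HolExt.partialDeriv j (HolExt.partialDeriv j v)) Ω E)
    (hlines : ∀ j : HolExt.RealIdx n, ∀ᵐ X : HolExt.Others j ∂μH[2 * (n : ℝ) - 1],
      (HolExt.slice j E X).Finite →
      ∀ x₀ ∈ HolExt.slice j E X, ∃ a b : ℕ → ℝ,
        (∀ l, a l ∈ HolExt.slice j (Ω \ E) X) ∧ (∀ l, b l ∈ HolExt.slice j (Ω \ E) X) ∧
        Monotone a ∧ Tendsto a atTop (𝓝 x₀) ∧ Antitone b ∧ Tendsto b atTop (𝓝 x₀) ∧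
        (∃ c : ℂ, Tendsto (fun l => f (HolExt.point j (a l) X)) atTop (𝓝 c) ∧
          Tendsto (fun l => f (HolExt.point j (b l) X)) atTop (𝓝 c)) ∧
        HolExt.MatchingSlopes j u X a b ∧ HolExt.MatchingSlopes j v X a b) :
    ∃ g : HolExt.CSpace n → ℂ,
      (DifferentiableOn ℂ g Ω ∧ Set.EqOn g f (Ω \ E)) ∧
      ∀ h : HolExt.CSpace n → ℂ,
        DifferentiableOn ℂ h Ω → Set.EqOn h f (Ω \ E) → Set.EqOn h g Ω := by
  subst hu hv
  have hW : IsOpen (Ω \ E) := by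
    have h := hΩ.isOpenMap_subtype_val _ hE.isOpen_compl
    convert! h using 1
    ext z
    simp
  have hE0 : volume E = 0 := volume_eq_zero_of_hausdorffMeasure_lt_top hEH
  have hdense : Ω ⊆ closure (Ω \ E) := by
    intro z hz
    refine mem_closure_iff.2 fun U hU hzU => ?_
    by_contra hne
    have hsub : U ∩ Ω ⊆ E := fun w hw => by
      by_contra hwE
      exact hne ⟨w, hw.1, hw.2, hwE⟩
    exact ((hU.inter hΩ).measure_pos volume ⟨z, hzU, hz⟩).ne' (measure_mono_null hsub hE0)
  have hfin := ae_finite_slice hn hEH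
  have hjump : ∀ j : RealIdx n, ∀ᵐ X : Others j ∂μH[2 * (n : ℝ) - 1],
      NoJump j f E X ∧ NoJump j (partialC j f) E X := fun j => by
    filter_upwards [hfin j, hlines j] with X h1 h2 using noJump_of_matching hW hf j (h2 h1)
  have hlocal : ∀ z₀ ∈ Ω, ∃ F : CSpace n → ℂ, ∃ U, IsOpen U ∧ z₀ ∈ U ∧ U ⊆ Ω ∧
      DifferentiableOn ℂ F U ∧ ∀ z ∈ U \ E, F z = f z := by
    intro z₀ hz₀
    obtain ⟨R, hR, hRΩ⟩ := Metric.nhds_basis_closedBall.mem_iff.1 (hΩ.mem_nhds hz₀)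
    obtain ⟨r, rfl⟩ : ∃ r, R = 2 * r := ⟨R / 2, by ring⟩
    have hr : 0 < r := by linarith
    set K := Metric.closedBall z₀ (2 * r) with hK
    have hKc : IsCompact K := isCompact_closedBall _ _
    have hfK : IntegrableOn f K := hf1.integrableOn_of_isCompact hE0 hKc hRΩ
    have hWE : K ⊆ (Ω \ E) ∪ E := fun z hz => by
      by_cases h : z ∈ E
      · exact Or.inr h
      · exact Or.inl ⟨hRΩ hz, h⟩
    -- Cutting `f` off outside `K` makes it globally integrable, as mollification requires; test
    -- functions supported in the smaller ball do not see the cut.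
    have hparts : ∀ φ : CSpace n → ℝ, ContDiff ℝ 1 φ → tsupport φ ⊆ Metric.ball z₀ r → ∀ j,
        ∫ z, fderiv ℝ φ z (dir j) • K.indicator f z = -∫ z, φ z • partialC j f z := by
      intro φ hφ hφs j
      rw [← integral_fderiv_smul_eq hn hW hf hE0 j hr hWE hfK
        (integrableOn_partialC hW hf hE0 j (hu2 j) (hv2 j) hKc hRΩ) (hfin j)
        ((hjump j).mono fun _ h => h.1) ((hjump j).mono fun _ h => h.2) hφ hφs]
      refine integral_congr_ae (ae_of_all _ fun z => ?_)
      by_cases hz : z ∈ K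
      · simp [hz]
      · have h0 : fderiv ℝ φ z = 0 := by
          by_contra hne
          have h1 := hφs (support_fderiv_subset ℝ hne)
          exact hz (Metric.ball_subset_closedBall.trans
            (Metric.closedBall_subset_closedBall (by linarith)) h1)
        simp [h0]
    obtain ⟨F, hF, hFf⟩ := exists_holomorphic_of_weak (f := K.indicator f)
      ((integrable_indicator_iff hKc.measurableSet).2 hfK) hr (z₀ := z₀) (by
        intro φ hφ hφs k
        -- Both sides become integrals of `φ` against pointwise derivatives of `f`, which satisfy
        -- the Cauchy-Riemann equations off the null set `E`.
        rw [hparts φ hφ hφs, hparts φ hφ hφs, mul_neg, ← integral_const_mul]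
        congr 1
        refine integral_congr_ae ?_
        filter_upwards [measure_eq_zero_iff_ae_notMem.1 hE0] with z hz
        by_cases hφz : φ z = 0
        · simp [hφz]
        · have hzK : z ∈ K := Metric.ball_subset_closedBall.trans
            (Metric.closedBall_subset_closedBall (by linarith)) (hφs (subset_tsupport φ hφz))
          rw [partialC_one hW hf k ⟨hRΩ hzK, hz⟩, mul_smul_comm])
    have hsub : Metric.ball z₀ (r / 4) ⊆ Metric.ball z₀ (2 * r) :=
      Metric.ball_subset_ball (by linarith)
    refine ⟨F, Metric.ball z₀ (r / 4), Metric.isOpen_ball, Metric.mem_ball_self (by positivity),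
      (hsub.trans Metric.ball_subset_closedBall).trans hRΩ, hF, fun z hz => ?_⟩
    have hzK : z ∈ K := Metric.ball_subset_closedBall (hsub hz.1)
    have hfc : ContinuousAt f z := (hf.differentiableAt (hW.mem_nhds ⟨hRΩ hzK, hz.2⟩)).continuousAt
    have hev : K.indicator f =ᶠ[𝓝 z] f := by
      filter_upwards [Metric.isOpen_ball.mem_nhds (hsub hz.1)] with w hw
      exact Set.indicator_of_mem (Metric.ball_subset_closedBall hw) f
    rw [hFf z hz.1 (hfc.congr hev.symm), hev.eq_of_nhds]
  -- Any continuous local extension is the limit of `f` from the dense set `Ω \ E`, so `extendFrom`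
  -- glues them all without choices. With `U = Ω` this is uniqueness.
  have hext : ∀ F : CSpace n → ℂ, ∀ U, IsOpen U → U ⊆ Ω → ContinuousOn F U →
      (∀ z ∈ U \ E, F z = f z) → ∀ z ∈ U, extendFrom (Ω \ E) f z = F z := by
    intro F U hU hUΩ hF hFf z hz
    refine extendFrom_eq (hdense (hUΩ hz)) ?_
    refine Tendsto.congr' ?_
      ((hF.continuousAt (hU.mem_nhds hz)).tendsto.mono_left nhdsWithin_le_nhds)
    filter_upwards [nhdsWithin_le_nhds (hU.mem_nhds hz), self_mem_nhdsWithin] with w hw hwE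
    exact hFf w ⟨hw, hwE.2⟩
  refine ⟨extendFrom (Ω \ E) f, ⟨fun z hz => ?_, fun z hz => ?_⟩, fun h hh hhf z hz => ?_⟩
  · obtain ⟨F, U, hU, hzU, hUΩ, hF, hFf⟩ := hlocal z hz
    refine DifferentiableAt.differentiableWithinAt ?_
    refine (hF.differentiableAt (hU.mem_nhds hzU)).congr_of_eventuallyEq ?_
    filter_upwards [hU.mem_nhds hzU] with w hw using hext F U hU hUΩ hF.continuousOn hFf w hw
  · exact hext f (Ω \ E) hW Set.sdiff_subset hf.continuousOn (fun _ _ => rfl) z hz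
  · exact (hext h Ω hΩ subset_rfl hh.continuousOn hhf z hz).symm
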